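/- Let $K(x,y)=\frac{\sin\pi(x-y)}{\pi(x-y)}$ (with $K(x,x)=1$) be the sine kernel, let $\lambda\in\mathbb R$, and for $s=2t>0$ let $$D(s;\lambda)=\det(1-\lambda K)=\sum_{n\ge0}\frac{(-\lambda)^n}{n!}\int_{(-t,t)^n}\det\bigl(K(x_i,x_j)\bigr)_{i,j=1}^n\,dx_1\cdots dx_n$$ be the Fredholm determinant of $\lambda K$ on the single interval $(-t,t)$; the series converges. If $\lambda\le1$, then $D(s;\lambda)>0$ for all $s>0$. Whenever $D(2t;\lambda)\ne0$, there is a unique continuous resolvent kernel $R(x,y)=R_t(x,y)$, the kernel of $(1-\lambda K)^{-1}\lambda K$ on $[-t,t]$ (that is, $R=\lambda K+\lambda KR=\lambda K+R\,\lambda K$); put $$\sigma(x;\lambda)=-2t\,R_t(t,t),\qquad x=2\pi t .$$ Then: 1. for every $x>0$ with $D(x/\pi;\lambda)\neq0$, $\ \sigma(x;\lambda)=x\,\frac{d}{dx}\log |D(x/\pi;\lambda)|$; 2. for every $s>0$ such that $D(\cdot;\lambda)$ has no zero in $(0,s]$ (hence for every $s>0$ if $\lambda\le1$), the function $\sigma(x;\lambda)/x$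 is integrable on $(0,\pi s)$ and $$D(s;\lambda)=\exp\Bigl(\int_0^{\pi s}\frac{\sigma(x;\lambda)}{x}\,dx\Bigr);$$ 3. at every $x>0$ with $D(x/\pi;\lambda)\ne0$, $\sigma$ is twice continuously differentiable and satisfies the Painlevé V $\sigma$-form equation $$(x\sigma'')^2+4(x\sigma'-\sigma)\bigl(x\sigma'-\sigma+(\sigma')^2\bigr)=0;$$ 4. $\sigma$ has the boundary behaviour $$\sigma(x;\lambda)=-\frac{\lambda}{\pi}x-\Bigl(\frac{\lambda}{\pi}\Bigr)^2x^2+O(x^3)\qquad(x\to0^+).$$ -/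

import Mathlib

open Real Set Filter Topology MeasureTheory

namespace SineProcess

noncomputable section

/-- The sine kernel `K(x,y) = sin (π (x - y)) / (π (x - y))`, with value `1` on the diagonal. -/
def sineKernel (x y : ℝ) : ℝ := Real.sinc (π * (x - y))

/-- The `n`-th term `((-lam)^n / n!) ∫_{I^n} det (k (x_i, x_j)) dx_1 ⋯ dx_n` of the
Fredholm expansion of `det (1 - lam k)` on `L²(I)`. -/
def fredholmTerm (k : ℝ → ℝ → ℝ) (I : Set ℝ) (lam : ℝ) (n : ℕ) : ℝ :=
  (-lam) ^ n / (Nat.factorial n : ℝ) *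
    ∫ x : Fin n → ℝ, (Matrix.of fun i j : Fin n => k (x i) (x j)).det
      ∂(Measure.pi fun _ : Fin n => (volume : Measure ℝ).restrict I)

/-- The Fredholm determinant `det (1 - lam k)` of the integral operator with kernel `k` on `I`,
as the sum of its Fredholm expansion. -/
def fredholmDet (k : ℝ → ℝ → ℝ) (I : Set ℝ) (lam : ℝ) : ℝ :=
  ∑' n : ℕ, fredholmTerm k I lam n

/-- `D(s; lam)`: the Fredholm determinant of the sine kernel on `(-t, t)`, where `s = 2 t`. -/
def D (s lam : ℝ) : ℝ := fredholmDet sineKernel (Ioo (-(s / 2)) (s / 2)) lam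

/-- `R` is the (continuous) kernel on `[-t, t]` of the resolvent `(1 - lam K)⁻¹ (lam K)`:
in terms of kernels, `R = lam K + lam K R` and `R = lam K + R lam K`. -/
structure IsResolventKernel (lam t : ℝ) (R : ℝ → ℝ → ℝ) : Prop where
  continuousOn : ContinuousOn (fun p : ℝ × ℝ => R p.1 p.2) (Icc (-t) t ×ˢ Icc (-t) t)
  left_eq : ∀ x ∈ Icc (-t) t, ∀ y ∈ Icc (-t) t,
    R x y = lam * sineKernel x y + ∫ z in (-t)..t, lam * sineKernel x z * R z y
  right_eq : ∀ x ∈ Icc (-t) t, ∀ y ∈ Icc (-t) t,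
    R x y = lam * sineKernel x y + ∫ z in (-t)..t, R x z * (lam * sineKernel z y)

/-- The resolvent kernel `R(x, y)` on `[-t, t]`
(determined there by `IsResolventKernel` as soon as one exists). -/
def resolventKernel (lam t : ℝ) : ℝ → ℝ → ℝ := Classical.epsilon (IsResolventKernel lam t)

/-- `σ(x; lam) = -2 t R(t, t)`, where `x = 2 π t`. -/
def sigma (lam x : ℝ) : ℝ :=
  -2 * (x / (2 * π)) * resolventKernel lam (x / (2 * π)) (x / (2 * π)) (x / (2 * π))

end

end SineProcess

/-! Rescaling to `[-1, 1]` moves the parameter into the kernel: with `x = t u` the sine kernel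
becomes `K_t(u, v) = t sinc (π t (u - v))`, whose `t`-derivative `cos (π t (u - v))` has rank two,
being `c ⊗ c + s ⊗ s` for `c = cos (π t ·)`, `s = sin (π t ·)`. Put `A = 1 - lam K_t`, `Q = A⁻¹ s`,
`P = A⁻¹ c`, `a = ⟨s, Q⟩`, `b = ⟨c, P⟩`, `q = Q(1)`, `p = P(1)`.

Fredholm's series, controlled by Hadamard's inequality, gives the determinant `D`, its first minor,
and an inverse of `A` wherever `D ≠ 0`. Differentiating the series termwise yields `D' = -lam (a +
b) D` (`hasDerivAt_detF`), and differentiating `A⁻¹` yields `(a + b)' = lam (a - b)²`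
(`hasDerivAt_aF_add_bF`).

Two commutators of `K_t` have low rank: with multiplication by `u`, because `(u - v) K_t` is `sin (π
t (u - v)) / π` (`opA_mul_idF`), and with `d/du`, which leaves boundary terms only
(`exists_hasDerivExt_of_opA`). Pairing these with `P` and `Q` gives `π t (a - b) = -2 p q`
(`mul_aF_sub_bF`), `a + b = 2 (p² + q²) - lam t (a - b)²` (`aF_add_bF_eq`), and the end value of the
resolvent kernel (`G_oneJ`). Hence `σ = -lam t (a + b)`, which is `x d/dx log |D|`. With `x = 2 π t`
one finds `σ' = -(lam / π)(p² + q²)`, `x σ' - σ = -(2 lam p q / π)²` and `x σ'' = 4 lam² p q (q² -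
p²) / π²`; the Painlevé equation is then the identity `(p² + q²)² - 4 p² q² = (p² - q²)²`. The
expansion at `0` comes from `a(0) = 0`, `b(0) = 2` and the equation for `a + b`.

For `lam ≤ 1`, `⟨f, K_t f⟩` is the part of the Fourier energy of `f` in a bounded band. Parseval and
analyticity of the Fourier transform exclude a nonzero solution of `f = lam K_t f`, so `A` is
invertible by compactness (`isUnit_opA`). The linear equation for `D` with `D(0) = 1` then keeps `D`
from vanishing (`detF_pos`). -/

namespace Fredholm

/-! ### Determinant identities behind Fredholm's recursion -/

/-- Hadamard's inequality for a real matrix with bounded entries. -/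
theorem abs_det_le_pow {n : ℕ} (A : Matrix (Fin n) (Fin n) ℝ) {B : ℝ} (h : ∀ i j, |A i j| ≤ B) :
    |A.det| ≤ (B * √n) ^ n := by
  let b := EuclideanSpace.basisFun (Fin n) ℝ
  have : Fact (Module.finrank ℝ (EuclideanSpace ℝ (Fin n)) = n) := ⟨by simp⟩
  let o := b.toBasis.orientation
  let v : Fin n → EuclideanSpace ℝ (Fin n) := fun i => WithLp.toLp 2 (A i)
  have h1 := o.abs_volumeForm_apply_le v
  rw [o.volumeForm_robust' b, Module.Basis.det_apply] at h1
  have h2 : b.toBasis.toMatrix v = A.transpose := by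
    ext i j
    simp [Module.Basis.toMatrix_apply, b, v]
  rw [h2, Matrix.det_transpose] at h1
  refine h1.trans ?_
  rw [← Fin.prod_const]
  refine Finset.prod_le_prod (fun i _ => norm_nonneg _) fun i _ => ?_
  have hB : 0 ≤ B := (abs_nonneg _).trans (h i i)
  rw [EuclideanSpace.norm_eq]
  refine Real.sqrt_le_iff.2 ⟨by positivity, ?_⟩
  calc ∑ j, ‖v i j‖ ^ 2 ≤ ∑ _j : Fin n, B ^ 2 :=
        Finset.sum_le_sum fun j _ => by
          have := h i j
          simp only [v, Real.norm_eq_abs]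
          gcongr
    _ = (B * √n) ^ 2 := by
        rw [mul_pow, Real.sq_sqrt (Nat.cast_nonneg n)]; simp [mul_comm]

variable {X : Type*}

/-- The matrix `k (a i) (b j)`. -/
def kerMat (k : X → X → ℝ) {n : ℕ} (a b : Fin n → X) : Matrix (Fin n) (Fin n) ℝ :=
  Matrix.of fun i j => k (a i) (b j)

/-- The matrix with rows `g (z j)` and `k (w i) (z j)`. -/
def rowMat (g : X → ℝ) (k : X → X → ℝ) {n : ℕ} (w : Fin n → X) (z : Fin (n + 1) → X) :
    Matrix (Fin (n + 1)) (Fin (n + 1)) ℝ :=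
  Matrix.of (Fin.cons (fun j => g (z j)) fun i j => k (w i) (z j))

theorem rowMat_kernel (k : X → X → ℝ) {n : ℕ} (x : X) (w : Fin n → X) (z : Fin (n + 1) → X) :
    rowMat (k x) k w z = kerMat k (Fin.cons x w) z := by
  ext i j
  refine Fin.cases ?_ (fun i => ?_) i <;> simp [rowMat, kerMat]

theorem det_kerMat_transpose {k : X → X → ℝ} (hk : ∀ x y, k x y = k y x) {n : ℕ}
    (a b : Fin n → X) : (kerMat k a b).det = (kerMat k b a).det := by
  rw [← Matrix.det_transpose]
  congr 1
  ext i j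
  simp [kerMat, hk (a j)]

theorem det_kerMat_cons_removeNth (k : X → X → ℝ) {n : ℕ} (w z : Fin (n + 1) → X)
    (p : Fin (n + 1)) :
    (kerMat k w z).det = (-1) ^ (p : ℕ) * (kerMat k (Fin.cons (w p) (p.removeNth w)) z).det := by
  rw [Fin.cons_removeNth_eq_comp_cycleRange_symm]
  have : kerMat k (w ∘ p.cycleRange.symm) z = (kerMat k w z).submatrix p.cycleRange.symm id := rfl
  rw [this, Matrix.det_permute, ← mul_assoc, Equiv.Perm.sign_symm, Fin.sign_cycleRange]
  simp [← mul_pow]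

/-- Expansion along the first row. In the term of column `w p`, the row `w p` is cycled to the front
to expose a Fredholm minor; the cycle's sign `(-1)^p` meets the cofactor sign `(-1)^(p+1)`, so every
such term carries the sign `-1`. -/
theorem det_rowMat_cons (g : X → ℝ) (k : X → X → ℝ) {n : ℕ} (y : X) (w : Fin (n + 1) → X) :
    (rowMat g k w (Fin.cons y w)).det = g y * (kerMat k w w).det -
      ∑ p : Fin (n + 1), g (w p) *
        (kerMat k (Fin.cons (w p) (p.removeNth w)) (Fin.cons y (p.removeNth w))).det := by
  rw [Matrix.det_succ_row_zero, Fin.sum_univ_succ, sub_eq_add_neg, ← Finset.sum_neg_distrib]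
  congr 1
  · simp only [Fin.val_zero, pow_zero, one_mul, rowMat, Matrix.of_apply, Fin.cons_zero]
    rfl
  · refine Finset.sum_congr rfl fun p _ => ?_
    have h1 : (rowMat g k w (Fin.cons y w)).submatrix Fin.succ p.succ.succAbove =
        kerMat k w (Fin.cons y (p.removeNth w)) := by
      ext i j
      refine Fin.cases ?_ (fun j => ?_) j <;> simp [rowMat, kerMat, Fin.removeNth]
    rw [h1, det_kerMat_cons_removeNth k w _ p]
    simp only [rowMat, Matrix.of_apply, Fin.cons_zero, Fin.cons_succ, Fin.val_succ, pow_succ]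
    linear_combination (-(g (w p) * (kerMat k (Fin.cons (w p) (p.removeNth w))
      (Fin.cons y (p.removeNth w))).det)) * (pow_mul_pow_eq_one (p : ℕ) (show (-1 : ℝ) * (-1) = 1 by norm_num))

/-- Cycling the index `p` to the front in rows and columns at once preserves the determinant. Each
summand of the derivative of a determinant thereby takes the shape handled by `det_rowMat_cons`. -/
theorem det_kerMat_updateRow (k : X → X → ℝ) (g : X → X → ℝ) {n : ℕ} (w : Fin (n + 1) → X)
    (p : Fin (n + 1)) :
    ((kerMat k w w).updateRow p fun j => g (w p) (w j)).det =
      (rowMat (g (w p)) k (p.removeNth w) (Fin.cons (w p) (p.removeNth w))).det := by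
  rw [Fin.cons_removeNth_eq_comp_cycleRange_symm,
    ← Matrix.det_submatrix_equiv_self p.cycleRange.symm]
  congr 1
  ext i j
  refine Fin.cases ?_ (fun i => ?_) i
  · simp [rowMat]
  · simp [rowMat, kerMat, Fin.cycleRange_symm_succ, Fin.removeNth]

/-- The determinant is a continuous multilinear function of its rows, so the product rule replaces
one row at a time. -/
theorem hasDerivAt_det {n : ℕ} {A : ℝ → Matrix (Fin n) (Fin n) ℝ} {A' : Matrix (Fin n) (Fin n) ℝ}
    {t : ℝ} (h : ∀ i j, HasDerivAt (fun s => A s i j) (A' i j) t) :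
    HasDerivAt (fun s => (A s).det) (∑ p, ((A t).updateRow p (A' p)).det) t := by
  let f : ContinuousMultilinearMap ℝ (fun _ : Fin n => Fin n → ℝ) ℝ :=
    { (Matrix.detRowAlternating (R := ℝ) (n := Fin n)).toMultilinearMap with
      cont := by
        change Continuous fun M : Matrix (Fin n) (Fin n) ℝ => M.det
        exact Continuous.matrix_det continuous_id }
  have hA : HasDerivAt (fun s => (fun i => A s i : Fin n → Fin n → ℝ)) A' t :=
    hasDerivAt_pi.2 fun i => hasDerivAt_pi.2 fun j => h i j
  have := (f.hasFDerivAt (A t)).comp_hasDerivAt t hA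
  convert! this using 1
  exact (ContinuousMultilinearMap.linearDeriv_apply f (A t) A').symm

end Fredholm

/-! ### Fredholm coefficients: continuity, recursion and bounds -/

namespace Fredholm

variable {X : Type*} [TopologicalSpace X]

theorem continuous_kerMat_det {Y : Type*} [TopologicalSpace Y] {k : X → X → ℝ}
    (hk : Continuous fun p : X × X => k p.1 p.2) {n : ℕ} {a b : Y → Fin n → X}
    (ha : Continuous a) (hb : Continuous b) : Continuous fun y => (kerMat k (a y) (b y)).det := by
  refine Continuous.matrix_det (continuous_pi fun i => continuous_pi fun j => ?_)
  exact hk.comp (((continuous_apply i).comp ha).prodMk ((continuous_apply j).comp hb))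

theorem continuous_rowMat_det {Y : Type*} [TopologicalSpace Y] {k : X → X → ℝ} {g : Y → X → ℝ}
    (hk : Continuous fun p : X × X => k p.1 p.2) (hg : Continuous fun p : Y × X => g p.1 p.2)
    {n : ℕ} {a : Y → Fin n → X} {b : Y → Fin (n + 1) → X}
    (ha : Continuous a) (hb : Continuous b) :
    Continuous fun y => (rowMat (g y) k (a y) (b y)).det := by
  refine Continuous.matrix_det (continuous_pi fun i => continuous_pi fun j => ?_)
  refine Fin.cases ?_ (fun i => ?_) i
  · simp only [rowMat, Matrix.of_apply, Fin.cons_zero]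
    exact hg.comp (continuous_id.prodMk ((continuous_apply j).comp hb))
  · simp only [rowMat, Matrix.of_apply, Fin.cons_succ]
    exact hk.comp (((continuous_apply i).comp ha).prodMk ((continuous_apply j).comp hb))

theorem continuous_cons {n : ℕ} {Y : Type*} [TopologicalSpace Y] {f : Y → X} {g : Y → Fin n → X}
    (hf : Continuous f) (hg : Continuous g) :
    Continuous fun y => (Fin.cons (f y) (g y) : Fin (n + 1) → X) := by
  refine continuous_pi fun i => ?_
  refine Fin.cases ?_ (fun i => ?_) i
  · simpa using hf
  · simpa using! (continuous_apply i).comp hg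

theorem continuous_removeNth {n : ℕ} (p : Fin (n + 1)) :
    Continuous fun w : Fin (n + 1) → X => p.removeNth w :=
  continuous_pi fun _ => continuous_apply _

variable [CompactSpace X] [T2Space X] [SecondCountableTopology X]
  [MeasurableSpace X] [BorelSpace X] {μ : Measure X} [IsFiniteMeasure μ]

theorem integrable_of_continuous {Y : Type*} [TopologicalSpace Y] [CompactSpace Y]
    [MeasurableSpace Y] [OpensMeasurableSpace Y] {ν : Measure Y} [IsFiniteMeasure ν] {f : Y → ℝ}
    (hf : Continuous f) : Integrable f ν :=
  hf.integrable_of_hasCompactSupport (HasCompactSupport.of_compactSpace f)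

theorem continuous_integral {Y Z : Type*} [TopologicalSpace Y] [CompactSpace Y]
    [SecondCountableTopology Y] [MeasurableSpace Y] [OpensMeasurableSpace Y] {ν : Measure Y}
    [IsFiniteMeasure ν] [TopologicalSpace Z] [FirstCountableTopology Z] [LocallyCompactSpace Z]
    {f : Z → Y → ℝ} (hf : Continuous fun p : Z × Y => f p.1 p.2) :
    Continuous fun z => ∫ y, f z y ∂ν := by
  have := continuous_parametric_integral_of_continuous (μ := ν) (f := f) hf isCompact_univ
  simpa using this

theorem integral_pi_removeNth {n : ℕ} (p : Fin (n + 1)) {f : X → (Fin n → X) → ℝ}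
    (hf : Continuous fun q : X × (Fin n → X) => f q.1 q.2) :
    ∫ w : Fin (n + 1) → X, f (w p) (p.removeNth w) ∂(Measure.pi fun _ => μ) =
      ∫ x, ∫ w, f x w ∂(Measure.pi fun _ => μ) ∂μ := by
  have h := measurePreserving_piFinSuccAbove (fun _ : Fin (n + 1) => μ) p
  rw [← integral_prod (fun q : X × (Fin n → X) => f q.1 q.2) (integrable_of_continuous hf),
    ← h.integral_comp']
  rfl

variable (μ) in
/-- The integral of the determinant `det (k (w i) (w j))` over `n` variables. -/
noncomputable def detCoeff (k : X → X → ℝ) (n : ℕ) : ℝ :=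
  ∫ w : Fin n → X, (kerMat k w w).det ∂(Measure.pi fun _ => μ)

variable (μ) in
/-- The integral over `w` of the determinant with rows `x, w` and columns `y, w`. -/
noncomputable def minorCoeff (k : X → X → ℝ) (n : ℕ) (x y : X) : ℝ :=
  ∫ w : Fin n → X, (kerMat k (Fin.cons x w) (Fin.cons y w)).det ∂(Measure.pi fun _ => μ)

variable {k : X → X → ℝ}

theorem detCoeff_zero : detCoeff μ k 0 = 1 := by
  simp [detCoeff, Measure.real]

theorem minorCoeff_zero (x y : X) : minorCoeff μ k 0 x y = k x y := by
  simp [minorCoeff, Measure.real, kerMat]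

theorem continuous_minorCoeff (hk : Continuous fun p : X × X => k p.1 p.2) (n : ℕ) :
    Continuous fun p : X × X => minorCoeff μ k n p.1 p.2 :=
  continuous_integral (Z := X × X) <| continuous_kerMat_det hk
    (continuous_cons (by fun_prop) (by fun_prop)) (continuous_cons (by fun_prop) (by fun_prop))

theorem integral_det_rowMat (hk : Continuous fun p : X × X => k p.1 p.2) {g : X → ℝ}
    (hg : Continuous g) (n : ℕ) (y : X) :
    ∫ w : Fin (n + 1) → X, (rowMat g k w (Fin.cons y w)).det ∂(Measure.pi fun _ => μ) =
      g y * detCoeff μ k (n + 1) - (n + 1) * ∫ z, g z * minorCoeff μ k n z y ∂μ := by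
  have hc (p : Fin (n + 1)) : Continuous fun w : Fin (n + 1) → X => g (w p) *
      (kerMat k (Fin.cons (w p) (p.removeNth w)) (Fin.cons y (p.removeNth w))).det :=
    (hg.comp (continuous_apply p)).mul (continuous_kerMat_det hk
      (continuous_cons (continuous_apply p) (continuous_removeNth p))
      (continuous_cons continuous_const (continuous_removeNth p)))
  have hp (p : Fin (n + 1)) : ∫ w : Fin (n + 1) → X, g (w p) *
      (kerMat k (Fin.cons (w p) (p.removeNth w)) (Fin.cons y (p.removeNth w))).det
        ∂(Measure.pi fun _ => μ) = ∫ z, g z * minorCoeff μ k n z y ∂μ := by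
    rw [integral_pi_removeNth p (f := fun x w => g x *
      (kerMat k (Fin.cons x w) (Fin.cons y w)).det)]
    · simp_rw [integral_const_mul]
      rfl
    · exact (hg.comp continuous_fst).mul (continuous_kerMat_det hk
        (continuous_cons continuous_fst continuous_snd)
        (continuous_cons continuous_const continuous_snd))
  simp_rw [det_rowMat_cons]
  rw [integral_sub, integral_finsetSum _ fun p _ => integrable_of_continuous (hc p),
    integral_const_mul]
  · simp [hp, detCoeff]
  · exact integrable_of_continuous
      (continuous_const.mul (continuous_kerMat_det hk continuous_id continuous_id))
  · exact integrable_of_continuous (continuous_finsetSum _ fun p _ => hc p)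

/-- Fredholm's recursion: after the first-row expansion the `n + 1` integrated variables play
symmetric roles, so their terms have equal integrals. -/
theorem minorCoeff_succ (hk : Continuous fun p : X × X => k p.1 p.2) (n : ℕ) (x y : X) :
    minorCoeff μ k (n + 1) x y = k x y * detCoeff μ k (n + 1) -
      (n + 1) * ∫ z, k x z * minorCoeff μ k n z y ∂μ := by
  have hx : Continuous (k x) := hk.comp (continuous_const.prodMk continuous_id)
  rw [← integral_det_rowMat hk hx]
  simp_rw [rowMat_kernel]
  rfl

theorem abs_integral_pi_le {n : ℕ} {f : (Fin n → X) → ℝ} {c : ℝ} (hf : ∀ w, |f w| ≤ c) :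
    |∫ w, f w ∂(Measure.pi fun _ => μ)| ≤ c * μ.real univ ^ n := by
  have := norm_integral_le_of_norm_le_const (μ := Measure.pi fun _ : Fin n => μ)
    (f := f) (Eventually.of_forall hf)
  simpa [Measure.real, Measure.pi_univ, ENNReal.toReal_pow] using this

theorem abs_detCoeff_le {B : ℝ} (hB : ∀ x y, |k x y| ≤ B) (n : ℕ) :
    |detCoeff μ k n| ≤ (B * √n) ^ n * μ.real univ ^ n :=
  abs_integral_pi_le fun _ => abs_det_le_pow _ fun _ _ => hB _ _

theorem abs_minorCoeff_le {B : ℝ} (hB : ∀ x y, |k x y| ≤ B) (n : ℕ) (x y : X) :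
    |minorCoeff μ k n x y| ≤ (B * √(n + 1)) ^ (n + 1) * μ.real univ ^ n := by
  refine abs_integral_pi_le fun _ => (abs_det_le_pow _ fun _ _ => hB _ _).trans ?_
  simp

/-- A substitute for Stirling's formula, from `n^n / n! ≤ exp n`. It lets half of the factorial
absorb Hadamard's factor `n^(n/2)`. -/
theorem sqrt_pow_le (n : ℕ) : √n ^ n ≤ rexp n * √(n.factorial) := by
  have h := Real.pow_div_factorial_le_exp (n : ℝ) (Nat.cast_nonneg n) n
  rw [div_le_iff₀ (by positivity)] at h
  calc √n ^ n = √((n : ℝ) ^ n) := by rw [Real.sqrt_eq_rpow, Real.sqrt_eq_rpow,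
        ← Real.rpow_natCast, ← Real.rpow_natCast, ← Real.rpow_mul (by positivity),
        ← Real.rpow_mul (by positivity), mul_comm]
    _ ≤ √(rexp n * n.factorial) := Real.sqrt_le_sqrt h
    _ = √(rexp n) * √(n.factorial) := Real.sqrt_mul (by positivity) _
    _ ≤ rexp n * √(n.factorial) := by
        gcongr
        rw [Real.sqrt_le_left (by positivity)]
        nlinarith [Real.one_le_exp (show (0 : ℝ) ≤ n by positivity)]

theorem summable_pow_div_sqrt_factorial {c : ℝ} (hc : 0 < c) :
    Summable fun n : ℕ => c ^ n / √(n.factorial) := by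
  refine summable_of_ratio_test_tendsto_lt_one (l := 0) zero_lt_one
    (Eventually.of_forall fun n => by positivity) ?_
  have h : Tendsto (fun n : ℕ => c * (√((n : ℝ) + 1))⁻¹) atTop (𝓝 (c * 0)) := by
    refine tendsto_const_nhds.mul (tendsto_inv_atTop_zero.comp (Real.tendsto_sqrt_atTop.comp ?_))
    exact tendsto_natCast_atTop_atTop.atTop_add tendsto_const_nhds
  rw [mul_zero] at h
  refine h.congr fun n => ?_
  rw [Real.norm_of_nonneg (by positivity), Real.norm_of_nonneg (by positivity),
    Nat.factorial_succ, Nat.cast_mul, Real.sqrt_mul (by positivity)]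
  push_cast
  rw [pow_succ]
  field_simp

/-- The extra factor `n` is there for the differentiated series, where a determinant of size `n`
produces `n` summands, and for the index shift in the minors. -/
theorem summable_hadamard {c : ℝ} (hc : 0 ≤ c) :
    Summable fun n : ℕ => c ^ n * √n ^ n * n / n.factorial := by
  have h := summable_pow_div_sqrt_factorial (c := (c + 1) * rexp 1 * 2) (by positivity)
  refine Summable.of_nonneg_of_le (fun n => by positivity) (fun n => ?_) h
  have h2 : (n : ℝ) ≤ 2 ^ n := by exact_mod_cast (Nat.lt_two_pow_self).le
  have h3 : (√(n.factorial : ℝ)) * √(n.factorial) = n.factorial :=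
    Real.mul_self_sqrt (by positivity)
  rw [div_le_div_iff₀ (by positivity) (by positivity)]
  calc c ^ n * √n ^ n * n * √(n.factorial)
      ≤ (c + 1) ^ n * (rexp n * √(n.factorial)) * 2 ^ n * √(n.factorial) := by
        gcongr
        · linarith
        · exact sqrt_pow_le n
    _ = ((c + 1) * rexp 1 * 2) ^ n * (√(n.factorial) * √(n.factorial)) := by
        rw [mul_pow, mul_pow, ← Real.exp_nat_mul, mul_one]
        ring
    _ = _ := by rw [h3]

end Fredholm

/-! ### The Fredholm determinant and first minor as series -/

namespace Fredholm

variable {X : Type*} [TopologicalSpace X] [CompactSpace X] [T2Space X] [SecondCountableTopology X]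
  [MeasurableSpace X] [BorelSpace X] {μ : Measure X} [IsFiniteMeasure μ]

variable (μ) in
/-- The Fredholm determinant of `1 - lam k`. -/
noncomputable def fredDet (k : X → X → ℝ) (lam : ℝ) : ℝ :=
  ∑' n : ℕ, (-lam) ^ n / n.factorial * detCoeff μ k n

variable (μ) in
/-- The first Fredholm minor of `1 - lam k`. -/
noncomputable def fredMinor (k : X → X → ℝ) (lam : ℝ) (x y : X) : ℝ :=
  ∑' n : ℕ, (-lam) ^ n / n.factorial * minorCoeff μ k n x y

variable {k : X → X → ℝ}

theorem exists_kernel_bound (hk : Continuous fun p : X × X => k p.1 p.2) :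
    ∃ B, 0 ≤ B ∧ ∀ x y, |k x y| ≤ B := by
  obtain ⟨B, hB⟩ := isCompact_univ.exists_bound_of_continuousOn hk.continuousOn
  exact ⟨max B 0, le_max_right _ _, fun x y => (hB (x, y) trivial).trans (le_max_left _ _)⟩

theorem summable_det_bound {B V lam : ℝ} (hB : 0 ≤ B) (hV : 0 ≤ V) :
    Summable fun n : ℕ => |lam| ^ n / n.factorial * (n * ((B * √n) ^ n * V ^ n)) := by
  refine (summable_hadamard (c := |lam| * B * V) (by positivity)).congr fun n => ?_
  simp only [mul_pow]
  ring

theorem summable_minor_bound {B V lam : ℝ} (hB : 0 ≤ B) (hV : 0 ≤ V) :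
    Summable fun n : ℕ =>
      |lam| ^ n / n.factorial * ((B * √(n + 1)) ^ (n + 1) * V ^ n) := by
  have h := (summable_nat_add_iff 1).2
    (summable_hadamard (c := B * (|lam| * V + 1)) (by positivity))
  refine Summable.of_nonneg_of_le (fun n => by positivity) (fun n => ?_) h
  have h1 : (|lam| * V) ^ n ≤ (|lam| * V + 1) ^ (n + 1) := by
    calc (|lam| * V) ^ n ≤ (|lam| * V + 1) ^ n := by gcongr; linarith
      _ ≤ _ := pow_le_pow_right₀ (by nlinarith [mul_nonneg (abs_nonneg lam) hV]) (Nat.le_succ n)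
  calc |lam| ^ n / n.factorial * ((B * √(n + 1)) ^ (n + 1) * V ^ n)
      = (|lam| * V) ^ n * (B ^ (n + 1) * √(n + 1) ^ (n + 1) / n.factorial) := by
        simp only [mul_pow]; ring
    _ ≤ (|lam| * V + 1) ^ (n + 1) * (B ^ (n + 1) * √(n + 1) ^ (n + 1) / n.factorial) := by
        gcongr
    _ = _ := by
        rw [Nat.factorial_succ]
        push_cast
        rw [mul_pow B]
        field_simp

theorem abs_coeff (lam : ℝ) (n : ℕ) :
    |(-lam) ^ n / (n.factorial : ℝ)| = |lam| ^ n / n.factorial := by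
  rw [abs_div, abs_pow, abs_neg, Nat.abs_cast]

theorem summable_fredDet (hk : Continuous fun p : X × X => k p.1 p.2) (lam : ℝ) :
    Summable fun n : ℕ => (-lam) ^ n / n.factorial * detCoeff μ k n := by
  obtain ⟨B, hB0, hB⟩ := exists_kernel_bound hk
  have h := summable_det_bound (lam := lam) hB0 (V := μ.real univ) measureReal_nonneg
  -- The majorant contains the factor `n` and so vanishes at `n = 0`; the comparison can only start
  -- at `n = 1`.
  rw [← summable_nat_add_iff 1] at h ⊢
  refine Summable.of_norm_bounded h fun n => ?_
  rw [norm_mul, Real.norm_eq_abs, Real.norm_eq_abs, abs_coeff]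
  refine mul_le_mul_of_nonneg_left ((abs_detCoeff_le hB _).trans ?_) (by positivity)
  refine le_mul_of_one_le_left (by positivity) ?_
  push_cast
  linarith [Nat.cast_nonneg (α := ℝ) n]

theorem exists_minor_bound (hk : Continuous fun p : X × X => k p.1 p.2) (lam : ℝ) :
    ∃ u : ℕ → ℝ, Summable u ∧
      ∀ n x y, ‖(-lam) ^ n / n.factorial * minorCoeff μ k n x y‖ ≤ u n := by
  obtain ⟨B, hB0, hB⟩ := exists_kernel_bound hk
  refine ⟨_, summable_minor_bound (lam := lam) hB0 (V := μ.real univ) measureReal_nonneg,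
    fun n x y => ?_⟩
  rw [norm_mul, Real.norm_eq_abs, Real.norm_eq_abs, abs_coeff]
  exact mul_le_mul_of_nonneg_left (abs_minorCoeff_le hB n x y) (by positivity)

theorem continuous_fredMinor (hk : Continuous fun p : X × X => k p.1 p.2) (lam : ℝ) :
    Continuous fun p : X × X => fredMinor μ k lam p.1 p.2 := by
  obtain ⟨u, hu, hle⟩ := exists_minor_bound (μ := μ) hk lam
  exact continuous_tsum (fun n => continuous_const.mul (continuous_minorCoeff hk n)) hu
    fun n p => hle n p.1 p.2

theorem fredMinor_symm (hk : ∀ x y, k x y = k y x) (lam : ℝ) (x y : X) :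
    fredMinor μ k lam x y = fredMinor μ k lam y x := by
  simp only [fredMinor, minorCoeff, det_kerMat_transpose hk (Fin.cons x _)]

theorem hasSum_integral_fredMinor (hk : Continuous fun p : X × X => k p.1 p.2) (lam : ℝ)
    {Y : Type*} [TopologicalSpace Y] [CompactSpace Y] [MeasurableSpace Y] [OpensMeasurableSpace Y]
    (ν : Measure Y) [IsFiniteMeasure ν] {g : Y → ℝ} {a b : Y → X} (hg : Continuous g)
    (ha : Continuous a) (hb : Continuous b) :
    HasSum (fun n : ℕ => (-lam) ^ n / n.factorial * ∫ z, g z * minorCoeff μ k n (a z) (b z) ∂ν)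
      (∫ z, g z * fredMinor μ k lam (a z) (b z) ∂ν) := by
  obtain ⟨u, hu, hle⟩ := exists_minor_bound (μ := μ) hk lam
  obtain ⟨G, hG⟩ := isCompact_univ.exists_bound_of_continuousOn hg.continuousOn
  have hc (n : ℕ) : Continuous fun z => g z * ((-lam) ^ n / n.factorial *
      minorCoeff μ k n (a z) (b z)) :=
    hg.mul (continuous_const.mul ((continuous_minorCoeff hk n).comp (ha.prodMk hb)))
  have h := hasSum_integral_of_summable_integral_norm (μ := ν)
    (F := fun n z => g z * ((-lam) ^ n / n.factorial * minorCoeff μ k n (a z) (b z)))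
    (fun n => integrable_of_continuous (hc n)) ?_
  · convert! h using 1
    · ext n
      rw [← integral_const_mul]
      congr 1 with z
      ring
    · simp only [fredMinor, tsum_mul_left]
  · refine Summable.of_nonneg_of_le (fun n => integral_nonneg fun _ => norm_nonneg _) (fun n => ?_)
      ((hu.mul_left |G|).mul_right (ν.real univ))
    have : ∀ z, ‖‖g z * ((-lam) ^ n / n.factorial * minorCoeff μ k n (a z) (b z))‖‖ ≤
        |G| * u n := fun z => by
      rw [norm_norm, norm_mul]
      exact mul_le_mul ((hG z trivial).trans (le_abs_self G)) (hle n _ _) (norm_nonneg _)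
        (abs_nonneg _)
    exact (le_abs_self _).trans
      (norm_integral_le_of_norm_le_const (μ := ν) (Eventually.of_forall this))

/-- The recursion `minorCoeff_succ` summed over `n`: the factor `n + 1` cancels against `(n + 1)!`,
and the spare `-lam` supplies the coefficient of the integral. -/
theorem fredMinor_eq (hk : Continuous fun p : X × X => k p.1 p.2) (lam : ℝ) (x y : X) :
    fredMinor μ k lam x y = k x y * fredDet μ k lam +
      lam * ∫ z, k x z * fredMinor μ k lam z y ∂μ := by
  obtain ⟨u, hu, hle⟩ := exists_minor_bound (μ := μ) hk lam
  have hs : Summable fun n : ℕ => (-lam) ^ n / n.factorial * minorCoeff μ k n x y :=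
    Summable.of_norm_bounded hu fun n => hle n x y
  have hF := summable_fredDet (μ := μ) hk lam
  have hx : Continuous (k x) := hk.comp (continuous_const.prodMk continuous_id)
  have hI := hasSum_integral_fredMinor (μ := μ) hk lam μ hx continuous_id
    (continuous_const (y := y))
  simp only [id] at hI
  rw [fredMinor, hs.tsum_eq_zero_add, fredDet, hF.tsum_eq_zero_add, ← hI.tsum_eq,
    mul_add, ← tsum_mul_left, ← tsum_mul_left, add_assoc,
    ← (((summable_nat_add_iff 1).2 hF).mul_left _).tsum_add (hI.summable.mul_left _)]
  simp only [minorCoeff_zero, detCoeff_zero, pow_zero, Nat.factorial_zero, Nat.cast_one, div_one,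
    one_mul, mul_one]
  congr 1
  refine tsum_congr fun n => ?_
  rw [minorCoeff_succ hk, Nat.factorial_succ]
  push_cast
  field_simp
  ring

/-- The derivative of `detCoeff` along a family of kernels with derivative `k'`. -/
noncomputable def detCoeffDeriv (μ : Measure X) (k k' : X → X → ℝ) (n : ℕ) : ℝ :=
  ∫ w : Fin n → X, ∑ p, ((kerMat k w w).updateRow p fun j => k' (w p) (w j)).det
    ∂(Measure.pi fun _ => μ)

theorem continuous_det_updateRow {k k' : X → X → ℝ} (hk : Continuous fun p : X × X => k p.1 p.2)
    (hk' : Continuous fun p : X × X => k' p.1 p.2) {n : ℕ} (p : Fin n) :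
    Continuous fun w : Fin n → X =>
      ((kerMat k w w).updateRow p fun j => k' (w p) (w j)).det := by
  refine Continuous.matrix_det (Continuous.matrix_updateRow p ?_ ?_)
  · exact continuous_pi fun i => continuous_pi fun j =>
      hk.comp (f := fun a : Fin n → X => (a i, a j)) (by fun_prop)
  · exact continuous_pi fun j => hk'.comp (f := fun a : Fin n → X => (a p, a j)) (by fun_prop)

theorem detCoeffDeriv_succ {k k' : X → X → ℝ} (hk : Continuous fun p : X × X => k p.1 p.2)
    (hk' : Continuous fun p : X × X => k' p.1 p.2) (n : ℕ) :
    detCoeffDeriv μ k k' (n + 1) =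
      (n + 1) * ∫ x, ∫ w : Fin n → X, (rowMat (k' x) k w (Fin.cons x w)).det
        ∂(Measure.pi fun _ => μ) ∂μ := by
  rw [detCoeffDeriv, integral_finsetSum _ fun p _ =>
    integrable_of_continuous (continuous_det_updateRow hk hk' p)]
  simp_rw [det_kerMat_updateRow]
  have hc : Continuous fun q : X × (Fin n → X) =>
      (rowMat (k' q.1) k q.2 (Fin.cons q.1 q.2)).det :=
    continuous_rowMat_det (g := fun q : X × (Fin n → X) => k' q.1) hk
      (hk'.comp ((continuous_fst.comp continuous_fst).prodMk continuous_snd)) continuous_snd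
      (continuous_cons continuous_fst continuous_snd)
  simp_rw [integral_pi_removeNth _ (f := fun x w => (rowMat (k' x) k w (Fin.cons x w)).det) hc]
  simp

theorem detCoeffDeriv_one {k k' : X → X → ℝ} (hk : Continuous fun p : X × X => k p.1 p.2)
    (hk' : Continuous fun p : X × X => k' p.1 p.2) :
    detCoeffDeriv μ k k' 1 = ∫ x, k' x x ∂μ := by
  rw [detCoeffDeriv_succ hk hk']
  simp [rowMat, Measure.real]

theorem detCoeffDeriv_succ_succ {k k' : X → X → ℝ} (hk : Continuous fun p : X × X => k p.1 p.2)
    (hk' : Continuous fun p : X × X => k' p.1 p.2) (n : ℕ) :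
    detCoeffDeriv μ k k' (n + 2) = (n + 2) * (detCoeff μ k (n + 1) * ∫ x, k' x x ∂μ -
      (n + 1) * ∫ p : X × X, k' p.1 p.2 * minorCoeff μ k n p.2 p.1 ∂(μ.prod μ)) := by
  rw [detCoeffDeriv_succ hk hk']
  have hx (x : X) : Continuous (k' x) := hk'.comp (continuous_const.prodMk continuous_id)
  have hd : Continuous fun x => k' x x := hk'.comp (continuous_id.prodMk continuous_id)
  have hm : Continuous fun p : X × X => k' p.1 p.2 * minorCoeff μ k n p.2 p.1 :=
    hk'.mul ((continuous_minorCoeff hk n).comp continuous_swap)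
  simp_rw [integral_det_rowMat hk (hx _)]
  rw [integral_prod _ (integrable_of_continuous hm), integral_sub, integral_mul_const,
    integral_const_mul]
  · push_cast
    ring
  · exact integrable_of_continuous (hd.mul continuous_const)
  · exact integrable_of_continuous (continuous_const.mul (continuous_integral hm))

theorem abs_detCoeffDeriv_le {k k' : X → X → ℝ} {B : ℝ} (hB : ∀ x y, |k x y| ≤ B)
    (hB' : ∀ x y, |k' x y| ≤ B) (n : ℕ) :
    |detCoeffDeriv μ k k' n| ≤ n * ((B * √n) ^ n * μ.real univ ^ n) := by
  rw [← mul_assoc]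
  refine abs_integral_pi_le fun w => (Finset.abs_sum_le_sum_abs _ _).trans ?_
  refine (Finset.sum_le_card_nsmul _ _ ((B * √n) ^ n) fun p _ => ?_).trans (by simp)
  refine abs_det_le_pow _ fun i j => ?_
  rw [Matrix.updateRow_apply]
  split_ifs
  exacts [hB' _ _, hB _ _]

section Family

variable {k k' : ℝ → X → X → ℝ} {B t₀ : ℝ} {U : Set ℝ}

theorem hasDerivAt_detCoeff (hU : IsOpen U)
    (hk : ∀ t, Continuous fun p : X × X => k t p.1 p.2)
    (hk' : ∀ t, Continuous fun p : X × X => k' t p.1 p.2)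
    (hd : ∀ t x y, HasDerivAt (fun s => k s x y) (k' t x y) t)
    (hB : ∀ t ∈ U, ∀ x y, |k t x y| ≤ B) (hB' : ∀ t ∈ U, ∀ x y, |k' t x y| ≤ B) (n : ℕ)
    {t : ℝ} (ht : t ∈ U) :
    HasDerivAt (fun s => detCoeff μ (k s) n) (detCoeffDeriv μ (k t) (k' t) n) t := by
  have hc (s : ℝ) : Continuous fun w : Fin n → X => (kerMat (k s) w w).det :=
    continuous_kerMat_det (hk s) continuous_id continuous_id
  have hc' (s : ℝ) : Continuous fun w : Fin n → X =>
      ∑ p, ((kerMat (k s) w w).updateRow p fun j => k' s (w p) (w j)).det :=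
    continuous_finsetSum _ fun p _ => continuous_det_updateRow (hk s) (hk' s) p
  refine (hasDerivAt_integral_of_dominated_loc_of_deriv_le
    (F' := fun s (w : Fin n → X) =>
      ∑ p, ((kerMat (k s) w w).updateRow p fun j => k' s (w p) (w j)).det)
    (bound := fun _ => n • (B * √n) ^ n) (hU.mem_nhds ht)
    (Eventually.of_forall fun s => (hc s).aestronglyMeasurable)
    (integrable_of_continuous (hc t)) (hc' t).aestronglyMeasurable
    (Eventually.of_forall fun w s hs => ?_) (integrable_const _)
    (Eventually.of_forall fun w s _ => ?_)).2
  · refine (Finset.abs_sum_le_sum_abs _ _).trans ?_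
    refine (Finset.sum_le_card_nsmul _ _ ((B * √n) ^ n) fun p _ => ?_).trans (by simp)
    refine abs_det_le_pow _ fun i j => ?_
    rw [Matrix.updateRow_apply]
    split_ifs
    exacts [hB' s hs _ _, hB s hs _ _]
  · exact hasDerivAt_det (A' := kerMat (k' s) w w) fun i j => hd s _ _

/-- Termwise differentiation under a uniform Hadamard majorant. The derivative is expressed by the
first minor and not by the resolvent, so it is also valid at zeros of the determinant. -/
theorem hasDerivAt_fredDet (hU : IsOpen U) (hU' : IsPreconnected U)
    (hk : ∀ t, Continuous fun p : X × X => k t p.1 p.2)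
    (hk' : ∀ t, Continuous fun p : X × X => k' t p.1 p.2)
    (hd : ∀ t x y, HasDerivAt (fun s => k s x y) (k' t x y) t)
    (hB : ∀ t ∈ U, ∀ x y, |k t x y| ≤ B) (hB' : ∀ t ∈ U, ∀ x y, |k' t x y| ≤ B) (hB0 : 0 ≤ B)
    (lam : ℝ) {t : ℝ} (ht : t ∈ U) :
    HasDerivAt (fun s => fredDet μ (k s) lam)
      (-lam * (fredDet μ (k t) lam * ∫ x, k' t x x ∂μ + lam *
        ∫ p : X × X, k' t p.1 p.2 * fredMinor μ (k t) lam p.2 p.1 ∂(μ.prod μ))) t := by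
  have hb : ∀ n : ℕ, ∀ s ∈ U, ‖(-lam) ^ n / n.factorial * detCoeffDeriv μ (k s) (k' s) n‖ ≤
      |lam| ^ n / n.factorial * (n * ((B * √n) ^ n * μ.real univ ^ n)) := fun n s hs => by
    rw [norm_mul, Real.norm_eq_abs, Real.norm_eq_abs, abs_coeff]
    exact mul_le_mul_of_nonneg_left (abs_detCoeffDeriv_le (hB s hs) (hB' s hs) n) (by positivity)
  have hu := summable_det_bound (lam := lam) hB0 (V := μ.real univ) measureReal_nonneg
  have hmain := hasDerivAt_tsum_of_isPreconnected hu hU hU'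
    (fun n s hs => (hasDerivAt_detCoeff (μ := μ) hU hk hk' hd hB hB' n hs).const_mul
      ((-lam) ^ n / n.factorial)) hb ht (summable_fredDet (hk t) lam) ht
  convert! hmain using 1
  have hs : Summable fun n : ℕ => (-lam) ^ n / n.factorial * detCoeffDeriv μ (k t) (k' t) n :=
    Summable.of_norm_bounded hu fun n => hb n t ht
  have hF := summable_fredDet (μ := μ) (hk t) lam
  have hI := hasSum_integral_fredMinor (μ := μ) (hk t) lam (μ.prod μ) (hk' t) continuous_snd
    continuous_fst
  rw [hs.tsum_eq_zero_add, ((summable_nat_add_iff 1).2 hs).tsum_eq_zero_add, fredDet,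
    hF.tsum_eq_zero_add, ← hI.tsum_eq, add_mul, ← tsum_mul_right, add_assoc, ← tsum_mul_left,
    ← (((summable_nat_add_iff 1).2 hF).mul_right _).tsum_add (hI.summable.mul_left _), mul_add,
    ← tsum_mul_left]
  have h0 : detCoeffDeriv μ (k t) (k' t) 0 = 0 := by simp [detCoeffDeriv]
  have h1 : detCoeffDeriv μ (k t) (k' t) (0 + 1) = ∫ x, k' t x x ∂μ :=
    detCoeffDeriv_one (hk t) (hk' t)
  rw [h0, h1, mul_zero, zero_add, detCoeff_zero]
  congr 1
  · simp
  · refine tsum_congr fun n => ?_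
    rw [detCoeffDeriv_succ_succ (hk t) (hk' t), Nat.factorial_succ (n + 1), Nat.factorial_succ n]
    push_cast
    field_simp
    ring

end Family

end Fredholm

/-! ### Integral operators on continuous functions and their resolvents -/

namespace Fredholm

variable {X : Type*} [TopologicalSpace X] [CompactSpace X] [T2Space X] [SecondCountableTopology X]
  [MeasurableSpace X] [BorelSpace X] {μ : Measure X} [IsFiniteMeasure μ]

theorem abs_integral_mul_le {f g : X → ℝ} {a b : ℝ} (hf : ∀ x, |f x| ≤ a) (hg : ∀ x, |g x| ≤ b)
    (ha : 0 ≤ a) : |∫ x, f x * g x ∂μ| ≤ μ.real univ * a * b := by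
  have : ∀ x, ‖f x * g x‖ ≤ a * b := fun x => by
    rw [norm_mul]
    exact mul_le_mul (hf x) (hg x) (abs_nonneg _) ha
  refine (norm_integral_le_of_norm_le_const (μ := μ) (Eventually.of_forall this)).trans_eq ?_
  ring

variable (μ) in
/-- The integral operator with continuous kernel `K`, as an operator on `C(X, ℝ)`. -/
noncomputable def kerOp : C(X × X, ℝ) →L[ℝ] C(X, ℝ) →L[ℝ] C(X, ℝ) :=
  LinearMap.mkContinuous₂
    (LinearMap.mk₂ ℝ
      (fun (K : C(X × X, ℝ)) (f : C(X, ℝ)) =>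
        (⟨fun x => ∫ z, K (x, z) * f z ∂μ, continuous_integral (by fun_prop)⟩ : C(X, ℝ)))
      (fun K L f => by
        ext x
        simp only [ContinuousMap.coe_mk, ContinuousMap.add_apply, add_mul]
        exact integral_add (integrable_of_continuous (by fun_prop))
          (integrable_of_continuous (by fun_prop)))
      (fun c K f => by
        ext x
        simp [mul_assoc, integral_const_mul])
      (fun K f g => by
        ext x
        simp only [ContinuousMap.coe_mk, ContinuousMap.add_apply, mul_add]
        exact integral_add (integrable_of_continuous (by fun_prop))
          (integrable_of_continuous (by fun_prop)))
      (fun c K f => by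
        ext x
        simp [mul_left_comm, integral_const_mul]))
    (μ.real univ)
    (fun K f => by
      refine (ContinuousMap.norm_le _ (by positivity)).2 fun x => ?_
      exact abs_integral_mul_le (fun z => K.norm_coe_le_norm _) (fun z => f.norm_coe_le_norm z)
        (norm_nonneg K))

theorem kerOp_apply (K : C(X × X, ℝ)) (f : C(X, ℝ)) (x : X) :
    kerOp μ K f x = ∫ z, K (x, z) * f z ∂μ := rfl

variable (μ) in
/-- The pairing `∫ f g` on `C(X, ℝ)`. -/
noncomputable def pairing : C(X, ℝ) →L[ℝ] C(X, ℝ) →L[ℝ] ℝ :=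
  LinearMap.mkContinuous₂
    (LinearMap.mk₂ ℝ (fun f g : C(X, ℝ) => ∫ x, f x * g x ∂μ)
      (fun f f' g => by
        simp only [ContinuousMap.add_apply, add_mul]
        exact integral_add (integrable_of_continuous (by fun_prop))
          (integrable_of_continuous (by fun_prop)))
      (fun c f g => by simp [mul_assoc, integral_const_mul])
      (fun f g g' => by
        simp only [ContinuousMap.add_apply, mul_add]
        exact integral_add (integrable_of_continuous (by fun_prop))
          (integrable_of_continuous (by fun_prop)))
      (fun c f g => by simp [mul_left_comm, integral_const_mul]))
    (μ.real univ)
    (fun f g => abs_integral_mul_le (fun z => f.norm_coe_le_norm _)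
      (fun z => g.norm_coe_le_norm z) (norm_nonneg f))

theorem pairing_apply (f g : C(X, ℝ)) : pairing μ f g = ∫ x, f x * g x ∂μ := rfl

theorem pairing_comm (f g : C(X, ℝ)) : pairing μ f g = pairing μ g f := by
  simp [pairing_apply, mul_comm]

theorem integral_integral_swap_continuous {f : X → X → ℝ}
    (hf : Continuous fun p : X × X => f p.1 p.2) :
    ∫ x, ∫ y, f x y ∂μ ∂μ = ∫ y, ∫ x, f x y ∂μ ∂μ :=
  integral_integral_swap (integrable_of_continuous hf)

theorem pairing_kerOp {K : C(X × X, ℝ)} (hK : ∀ x y, K (x, y) = K (y, x)) (f g : C(X, ℝ)) :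
    pairing μ f (kerOp μ K g) = pairing μ (kerOp μ K f) g := by
  simp only [pairing_apply, kerOp_apply, ← integral_const_mul, ← integral_mul_const]
  rw [integral_integral_swap_continuous (by fun_prop)]
  congr 1 with x
  congr 1 with y
  rw [hK x y]
  ring

theorem kerOp_mul {K L M : C(X × X, ℝ)} (h : ∀ x y, M (x, y) = ∫ z, K (x, z) * L (z, y) ∂μ) :
    kerOp μ K * kerOp μ L = kerOp μ M := by
  ext f x
  simp only [mul_apply_eq_comp, kerOp_apply, h, ← integral_const_mul,
    ← integral_mul_const]
  rw [integral_integral_swap_continuous (by fun_prop)]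
  simp only [mul_assoc]

variable (μ) in
/-- The first Fredholm minor as a continuous kernel. -/
noncomputable def minorKer (K : C(X × X, ℝ)) (lam : ℝ) : C(X × X, ℝ) :=
  ⟨fun p => fredMinor μ (fun x y => K (x, y)) lam p.1 p.2, continuous_fredMinor (by fun_prop) lam⟩

variable (μ) in
/-- The Fredholm determinant of a continuous kernel. -/
noncomputable abbrev kerDet (K : C(X × X, ℝ)) (lam : ℝ) : ℝ :=
  fredDet μ (fun x y => K (x, y)) lam

variable {K : C(X × X, ℝ)} {lam : ℝ}

theorem minorKer_eq (x y : X) :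
    minorKer μ K lam (x, y) = K (x, y) * kerDet μ K lam +
      lam * ∫ z, K (x, z) * minorKer μ K lam (z, y) ∂μ :=
  fredMinor_eq (k := fun x y => K (x, y)) (by fun_prop) lam x y

theorem minorKer_symm (hK : ∀ x y, K (x, y) = K (y, x)) (x y : X) :
    minorKer μ K lam (x, y) = minorKer μ K lam (y, x) :=
  fredMinor_symm (k := fun x y => K (x, y)) hK lam x y

theorem kerOp_minorKer : kerOp μ (minorKer μ K lam) = kerDet μ K lam • kerOp μ K +
    lam • (kerOp μ K * kerOp μ (minorKer μ K lam)) := by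
  let M : C(X × X, ℝ) :=
    ⟨fun p => ∫ z, K (p.1, z) * minorKer μ K lam (z, p.2) ∂μ, continuous_integral (by fun_prop)⟩
  rw [kerOp_mul (M := M) fun x y => rfl, ← map_smul, ← map_smul, ← map_add]
  congr 1
  ext ⟨x, y⟩
  rw [minorKer_eq]
  simp [M, mul_comm]

/-- The transpose of `kerOp_minorKer`, available because a symmetric kernel has a symmetric minor.
The two versions give the two sides of the inverse. -/
theorem kerOp_minorKer' (hK : ∀ x y, K (x, y) = K (y, x)) :
    kerOp μ (minorKer μ K lam) = kerDet μ K lam • kerOp μ K +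
      lam • (kerOp μ (minorKer μ K lam) * kerOp μ K) := by
  let M : C(X × X, ℝ) :=
    ⟨fun p => ∫ z, minorKer μ K lam (p.1, z) * K (z, p.2) ∂μ, continuous_integral (by fun_prop)⟩
  rw [kerOp_mul (M := M) fun x y => rfl, ← map_smul, ← map_smul, ← map_add]
  congr 1
  ext ⟨x, y⟩
  rw [minorKer_symm hK, minorKer_eq, hK y x]
  simp [M, mul_comm, hK _ y, minorKer_symm hK x]

/-- Fredholm's formula: the inverse is `1 + (lam / D) N`, with `N` the operator of the first minor.
-/
theorem isUnit_one_sub_kerOp (hK : ∀ x y, K (x, y) = K (y, x)) (hD : kerDet μ K lam ≠ 0) :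
    IsUnit (1 - lam • kerOp μ K) := by
  have h1 := kerOp_minorKer (μ := μ) (K := K) (lam := lam)
  have h2 := kerOp_minorKer' (μ := μ) (lam := lam) hK
  set D := kerDet μ K lam
  set T := kerOp μ K
  set N := kerOp μ (minorKer μ K lam)
  refine ⟨⟨1 - lam • T, 1 + (lam / D) • N, ?_, ?_⟩, rfl⟩
  · have : (1 - lam • T) * (1 + (lam / D) • N) =
        1 + (lam / D) • (N - lam • (T * N)) - lam • T := by
      simp only [sub_mul, mul_add, smul_mul_assoc, mul_smul_comm, one_mul, mul_one, smul_sub,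
        smul_smul]
      rw [mul_comm (lam / D) lam]
      abel
    rw [this]
    nth_rw 1 [h1]
    rw [add_sub_cancel_right, smul_smul, div_mul_cancel₀ _ hD, add_sub_cancel_right]
  · have : (1 + (lam / D) • N) * (1 - lam • T) =
        1 + (lam / D) • (N - lam • (N * T)) - lam • T := by
      simp only [mul_sub, add_mul, smul_mul_assoc, mul_smul_comm, one_mul, mul_one, smul_sub,
        smul_smul, smul_add]
      rw [mul_comm (lam / D) lam]
      abel
    rw [this]
    nth_rw 1 [h2]
    rw [add_sub_cancel_right, smul_smul, div_mul_cancel₀ _ hD, add_sub_cancel_right]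

/-- Multiplying Fredholm's equation by the inverse avoids dividing by `D`. Only invertibility is
used, so the formula can later serve to prove `D ≠ 0`. -/
theorem smul_kerOp_minorKer (hU : IsUnit (1 - lam • kerOp μ K)) :
    lam • kerOp μ (minorKer μ K lam) =
      kerDet μ K lam • (Ring.inverse (1 - lam • kerOp μ K) - 1) := by
  have h1 := kerOp_minorKer (μ := μ) (K := K) (lam := lam)
  set D := kerDet μ K lam
  set T := kerOp μ K
  set N := kerOp μ (minorKer μ K lam)
  have h2 : (1 - lam • T) * N = D • T := by
    rw [sub_mul, one_mul, smul_mul_assoc]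
    nth_rw 1 [h1]
    rw [add_sub_cancel_right]
  have h3 : N = Ring.inverse (1 - lam • T) * (D • T) := by
    rw [← h2, Ring.inverse_mul_cancel_left _ _ hU]
  have h4 : Ring.inverse (1 - lam • T) * (lam • T) = Ring.inverse (1 - lam • T) - 1 := by
    have := Ring.inverse_mul_cancel _ hU
    rw [mul_sub, mul_one] at this
    exact eq_sub_of_add_eq' (sub_eq_iff_eq_add.1 this).symm
  rw [← h4, h3, mul_smul_comm, mul_smul_comm, smul_comm]

/-- For the rank-two derivative `c ⊗ c + s ⊗ s` the trace term and the minor term combine: the `-1`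
in `A⁻¹ - 1` cancels the trace, leaving quadratic forms of `A⁻¹`. -/
theorem deriv_fredDet_eq (hU : IsUnit (1 - lam • kerOp μ K)) (c s : C(X, ℝ)) :
    kerDet μ K lam * ∫ x, (c x * c x + s x * s x) ∂μ + lam *
        ∫ p : X × X, (c p.1 * c p.2 + s p.1 * s p.2) * minorKer μ K lam (p.2, p.1) ∂(μ.prod μ) =
      kerDet μ K lam * (pairing μ c (Ring.inverse (1 - lam • kerOp μ K) c) +
        pairing μ s (Ring.inverse (1 - lam • kerOp μ K) s)) := by
  have key (f : C(X, ℝ)) : pairing μ f ((lam • kerOp μ (minorKer μ K lam)) f) =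
      lam * ∫ p : X × X, f p.1 * f p.2 * minorKer μ K lam (p.2, p.1) ∂(μ.prod μ) := by
    rw [integral_prod_symm _ (integrable_of_continuous (by fun_prop))]
    simp only [_root_.smul_apply, map_smul, smul_eq_mul, pairing_apply, kerOp_apply,
      ← integral_const_mul]
    congr 1 with x
    congr 1 with y
    ring
  have h1 : ∫ x, (c x * c x + s x * s x) ∂μ = pairing μ c c + pairing μ s s :=
    integral_add (integrable_of_continuous (by fun_prop)) (integrable_of_continuous (by fun_prop))
  simp only [add_mul]
  rw [h1, integral_add (integrable_of_continuous (by fun_prop))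
    (integrable_of_continuous (by fun_prop)), mul_add lam, ← key, ← key, smul_kerOp_minorKer hU]
  simp only [_root_.smul_apply, _root_.sub_apply,
    one_apply_eq_self, map_smul, map_sub, smul_eq_mul]
  ring

end Fredholm

/-! ### The sine kernel rescaled to a fixed interval -/

namespace SineProcess

open Fredholm

/-- A curve in `C(X, ℝ)` is differentiable if it is so pointwise, with a derivative that is
continuous as a curve in `C(X, ℝ)`. -/
theorem eq_add_integral_continuousMap {X : Type*} [TopologicalSpace X] [CompactSpace X]
    {F F' : ℝ → C(X, ℝ)} (hF' : Continuous F')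
    (h : ∀ t x, HasDerivAt (fun s => F s x) (F' t x) t) (t : ℝ) :
    F t = F 0 + ∫ s in (0 : ℝ)..t, F' s := by
  ext x
  have h1 : ∫ s in (0 : ℝ)..t, F' s x = (∫ s in (0 : ℝ)..t, F' s) x :=
    (ContinuousMap.evalCLM ℝ x).intervalIntegral_comp_comm
      (hF'.intervalIntegrable (μ := volume) 0 t)
  have h2 := intervalIntegral.integral_eq_sub_of_hasDerivAt (a := 0) (b := t)
    (fun s _ => h s x)
    (((ContinuousMap.evalCLM ℝ x).continuous.comp hF').intervalIntegrable 0 t)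
  rw [ContinuousMap.add_apply, ← h1]
  exact eq_add_of_sub_eq' h2.symm

/-- The curve is a primitive of a continuous curve in the Banach space `C(X, ℝ)`, so the fundamental
theorem of calculus upgrades pointwise differentiation to the supremum norm. -/
theorem hasDerivAt_continuousMap {X : Type*} [TopologicalSpace X] [CompactSpace X]
    {F F' : ℝ → C(X, ℝ)} (hF' : Continuous F')
    (h : ∀ t x, HasDerivAt (fun s => F s x) (F' t x) t) (t : ℝ) : HasDerivAt F (F' t) t := by
  have h1 : F = fun s => F 0 + ∫ r in (0 : ℝ)..s, F' r :=
    funext fun s => eq_add_integral_continuousMap hF' h s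
  rw [h1]
  exact (hF'.integral_hasStrictDerivAt 0 t).hasDerivAt.const_add _

/-- The interval `[-1, 1]`. -/
abbrev J : Type := Icc (-1 : ℝ) 1

/-- Lebesgue measure on `[-1, 1]`. -/
noncomputable def muJ : Measure J := Measure.comap Subtype.val volume

theorem integral_muJ (f : ℝ → ℝ) : ∫ x : J, f x ∂muJ = ∫ x in (-1 : ℝ)..1, f x := by
  rw [intervalIntegral.integral_of_le (by norm_num), ← integral_Icc_eq_integral_Ioc]
  exact integral_subtype_comap measurableSet_Icc f

instance : IsFiniteMeasure muJ := by
  refine ⟨?_⟩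
  rw [muJ, comap_subtype_coe_apply measurableSet_Icc, image_univ, Subtype.range_coe,
    Real.volume_Icc]
  exact ENNReal.ofReal_lt_top

/-- The continuous function `cos (π t u)` of `u`. -/
noncomputable def cosF (t : ℝ) : C(J, ℝ) := ⟨fun u => cos (π * t * u), by fun_prop⟩

/-- The continuous function `sin (π t u)` of `u`. -/
noncomputable def sinF (t : ℝ) : C(J, ℝ) := ⟨fun u => sin (π * t * u), by fun_prop⟩

/-- The coordinate function. -/
noncomputable def idF : C(J, ℝ) := ⟨fun u => u, by fun_prop⟩

@[simp] theorem cosF_apply (t : ℝ) (u : J) : cosF t u = cos (π * t * u) := rfl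
@[simp] theorem sinF_apply (t : ℝ) (u : J) : sinF t u = sin (π * t * u) := rfl
@[simp] theorem idF_apply (u : J) : idF u = u := rfl

theorem continuous_cosF : Continuous cosF :=
  ContinuousMap.continuous_of_continuous_uncurry _
    (show Continuous fun p : ℝ × J => cos (π * p.1 * p.2) by fun_prop)

theorem continuous_sinF : Continuous sinF :=
  ContinuousMap.continuous_of_continuous_uncurry _
    (show Continuous fun p : ℝ × J => sin (π * p.1 * p.2) by fun_prop)

theorem hasDerivAt_cosF (t : ℝ) : HasDerivAt cosF (-(π • (idF * sinF t))) t := by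
  refine hasDerivAt_continuousMap (F' := fun t => -(π • (idF * sinF t))) ?_ (fun s u => ?_) t
  · exact ((continuous_const.mul continuous_sinF).const_smul π).neg
  · have := (((hasDerivAt_id s).const_mul π).mul_const (u : ℝ)).cos
    refine this.congr_deriv ?_
    simp
    ring

theorem hasDerivAt_sinF (t : ℝ) : HasDerivAt sinF (π • (idF * cosF t)) t := by
  refine hasDerivAt_continuousMap (F' := fun t => π • (idF * cosF t)) ?_ (fun s u => ?_) t
  · exact (continuous_const.mul continuous_cosF).const_smul π
  · have := (((hasDerivAt_id s).const_mul π).mul_const (u : ℝ)).sin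
    refine this.congr_deriv ?_
    simp
    ring

theorem sinc_mul_self (x : ℝ) : x * sinc x = sin x := by
  rcases eq_or_ne x 0 with rfl | h
  · simp
  · rw [sinc_of_ne_zero h]
    field_simp

/-- The rescaled sine kernel, as a function of the difference of its arguments. -/
noncomputable def kap (t w : ℝ) : ℝ := t * sinc (π * t * w)

theorem continuous_kap (t : ℝ) : Continuous (kap t) := by
  have := continuous_sinc
  unfold kap
  fun_prop

theorem kap_neg (t w : ℝ) : kap t (-w) = kap t w := by
  rw [kap, kap, mul_neg, sinc_neg]

theorem mul_kap (t w : ℝ) : w * kap t w = sin (π * t * w) / π := by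
  rw [kap, eq_div_iff pi_pos.ne', ← sinc_mul_self]
  ring

theorem hasDerivAt_kap (t w : ℝ) : HasDerivAt (fun s => kap s w) (cos (π * t * w)) t := by
  rcases eq_or_ne w 0 with rfl | h
  · simpa [kap] using! hasDerivAt_id t
  · have h1 : (fun s => kap s w) = fun s => sin (π * s * w) / π / w :=
      funext fun s => by rw [← mul_kap]; field_simp
    rw [h1]
    have := (((((hasDerivAt_id t).const_mul π).mul_const w).sin).div_const π).div_const w
    refine this.congr_deriv ?_
    simp only [id]
    field_simp

/-- The rescaled sine kernel on `[-1, 1]`. -/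
noncomputable def sinKer (t : ℝ) : C(J × J, ℝ) :=
  ⟨fun p => kap t (p.1 - p.2), (continuous_kap t).comp (by fun_prop)⟩

/-- The derivative of the rescaled sine kernel with respect to the scale. -/
noncomputable def cosKer (t : ℝ) : C(J × J, ℝ) :=
  ⟨fun p => cosF t p.1 * cosF t p.2 + sinF t p.1 * sinF t p.2, by fun_prop⟩

theorem sinKer_apply (t : ℝ) (u v : J) : sinKer t (u, v) = kap t (u - v) := rfl

theorem cosKer_apply (t : ℝ) (u v : J) :
    cosKer t (u, v) = cosF t u * cosF t v + sinF t u * sinF t v := rfl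

theorem sinKer_symm (t : ℝ) (u v : J) : sinKer t (u, v) = sinKer t (v, u) := by
  rw [sinKer_apply, sinKer_apply, ← kap_neg, neg_sub]

theorem continuous_cosKer : Continuous cosKer :=
  ContinuousMap.continuous_of_continuous_uncurry _
    (show Continuous fun p : ℝ × (J × J) => cos (π * p.1 * p.2.1) * cos (π * p.1 * p.2.2) +
      sin (π * p.1 * p.2.1) * sin (π * p.1 * p.2.2) by fun_prop)

theorem hasDerivAt_kap_sub (t : ℝ) (p : J × J) :
    HasDerivAt (fun s => sinKer s p) (cosKer t p) t := by
  refine (hasDerivAt_kap t (p.1 - p.2)).congr_deriv ?_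
  rw [mul_sub, cos_sub]
  rfl

theorem hasDerivAt_sinKer (t : ℝ) : HasDerivAt sinKer (cosKer t) t :=
  hasDerivAt_continuousMap continuous_cosKer hasDerivAt_kap_sub t

theorem sinKer_zero : sinKer 0 = 0 := by
  ext p
  simp [sinKer, kap]

theorem sinKer_eq_integral (t : ℝ) : sinKer t = ∫ s in (0 : ℝ)..t, cosKer s := by
  have := eq_add_integral_continuousMap continuous_cosKer hasDerivAt_kap_sub t
  rwa [sinKer_zero, zero_add] at this

/-- The pairing `∫ f g` on `[-1, 1]`. -/
noncomputable abbrev ip : C(J, ℝ) →L[ℝ] C(J, ℝ) →L[ℝ] ℝ := pairing muJ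

theorem kerOp_cosKer (t : ℝ) (f : C(J, ℝ)) :
    kerOp muJ (cosKer t) f = ip (cosF t) f • cosF t + ip (sinF t) f • sinF t := by
  ext u
  simp only [kerOp_apply, cosKer_apply, add_mul, mul_assoc]
  rw [integral_add (integrable_of_continuous (by fun_prop))
    (integrable_of_continuous (by fun_prop)), integral_const_mul, integral_const_mul]
  simp [pairing_apply, mul_comm]

/-- The operator `1 - lam K` on `C([-1, 1], ℝ)`, with `K` the rescaled sine kernel. -/
noncomputable def opA (lam t : ℝ) : C(J, ℝ) →L[ℝ] C(J, ℝ) := 1 - lam • kerOp muJ (sinKer t)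

/-- The inverse of `1 - lam K`. -/
noncomputable def inv (lam t : ℝ) : C(J, ℝ) →L[ℝ] C(J, ℝ) := Ring.inverse (opA lam t)

/-- The function `(1 - lam K)⁻¹ sin (π t ·)`. -/
noncomputable def Q (lam t : ℝ) : C(J, ℝ) := inv lam t (sinF t)

/-- The function `(1 - lam K)⁻¹ cos (π t ·)`. -/
noncomputable def P (lam t : ℝ) : C(J, ℝ) := inv lam t (cosF t)

/-! ### Self-adjointness, parity, and the commutator with the coordinate -/

section Fixed

variable {lam t : ℝ}

theorem opA_apply (f : C(J, ℝ)) : opA lam t f = f - lam • kerOp muJ (sinKer t) f := rfl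

theorem inv_opA (h : IsUnit (opA lam t)) (f : C(J, ℝ)) : inv lam t (opA lam t f) = f := by
  rw [inv, ← mul_apply_eq_comp, Ring.inverse_mul_cancel _ h, one_apply_eq_self]

theorem opA_inv (h : IsUnit (opA lam t)) (f : C(J, ℝ)) : opA lam t (inv lam t f) = f := by
  rw [inv, ← mul_apply_eq_comp, Ring.mul_inverse_cancel _ h, one_apply_eq_self]

theorem ip_opA (f g : C(J, ℝ)) : ip f (opA lam t g) = ip (opA lam t f) g := by
  simp only [opA_apply, map_sub, map_smul, _root_.sub_apply, _root_.smul_apply]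
  rw [pairing_kerOp (sinKer_symm t)]

theorem ip_inv (h : IsUnit (opA lam t)) (f g : C(J, ℝ)) :
    ip f (inv lam t g) = ip (inv lam t f) g := by
  nth_rw 1 [← opA_inv h f]
  rw [← ip_opA, opA_inv h]

/-- The reflection of `[-1, 1]`. -/
def negJ : C(J, J) := ⟨fun u => ⟨-u, by have := u.2; constructor <;> linarith [this.1, this.2]⟩,
  by fun_prop⟩

@[simp] theorem coe_negJ (u : J) : ((negJ u : J) : ℝ) = -u := rfl

theorem integral_comp_negJ (f : C(J, ℝ)) : ∫ u, f (negJ u) ∂muJ = ∫ u, f u ∂muJ := by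
  let g : ℝ → ℝ := fun x => f (projIcc (-1) 1 (by norm_num) x)
  have h1 : ∀ u : J, f u = g u := fun u => by simp [g]
  simp only [h1, coe_negJ]
  rw [integral_muJ g, integral_muJ fun x => g (-x), intervalIntegral.integral_comp_neg, neg_neg]

theorem opA_comp_negJ (f : C(J, ℝ)) : opA lam t (f.comp negJ) = (opA lam t f).comp negJ := by
  ext u
  simp only [opA_apply, ContinuousMap.sub_apply, ContinuousMap.smul_apply, ContinuousMap.comp_apply,
    kerOp_apply]
  let g : C(J, ℝ) := ⟨fun v => sinKer t (negJ u, v) * f v, by fun_prop⟩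
  have := integral_comp_negJ g
  simp only [g, ContinuousMap.coe_mk] at this
  rw [← this]
  congr 3
  ext v
  rw [sinKer_apply, sinKer_apply, ← kap_neg]
  congr 2
  simp
  ring

theorem inv_comp_negJ (h : IsUnit (opA lam t)) (f : C(J, ℝ)) :
    inv lam t (f.comp negJ) = (inv lam t f).comp negJ := by
  nth_rw 1 [← opA_inv h f]
  rw [← opA_comp_negJ, inv_opA h]

theorem Q_negJ (h : IsUnit (opA lam t)) (u : J) : Q lam t (negJ u) = -Q lam t u := by
  have h1 : (sinF t).comp negJ = -sinF t := by ext u; simp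
  have := inv_comp_negJ h (sinF t)
  rw [h1, map_neg] at this
  exact (DFunLike.congr_fun this u).symm

theorem P_negJ (h : IsUnit (opA lam t)) (u : J) : P lam t (negJ u) = P lam t u := by
  have h1 : (cosF t).comp negJ = cosF t := by ext u; simp
  have := inv_comp_negJ h (cosF t)
  rw [h1] at this
  exact (DFunLike.congr_fun this u).symm

theorem ip_eq_zero {f g : C(J, ℝ)} (hf : ∀ u, f (negJ u) = f u) (hg : ∀ u, g (negJ u) = -g u) :
    ip f g = 0 := by
  have := integral_comp_negJ (f * g)
  simp only [ContinuousMap.mul_apply, hf, hg, mul_neg, integral_neg] at this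
  rw [pairing_apply]
  linarith

theorem ip_cosF_Q (h : IsUnit (opA lam t)) : ip (cosF t) (Q lam t) = 0 :=
  ip_eq_zero (fun u => by simp) (Q_negJ h)

theorem ip_P_sinF (h : IsUnit (opA lam t)) : ip (P lam t) (sinF t) = 0 :=
  ip_eq_zero (P_negJ h) fun u => by simp

theorem ip_sinF_P (h : IsUnit (opA lam t)) : ip (sinF t) (P lam t) = 0 := by
  rw [pairing_comm, ip_P_sinF h]

/-- The commutator of multiplication by the coordinate with `1 - lam K`. -/
theorem opA_mul_idF (f : C(J, ℝ)) : opA lam t (idF * f) = idF * opA lam t f +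
    (lam / π) • (ip (cosF t) f • sinF t - ip (sinF t) f • cosF t) := by
  have key : idF * kerOp muJ (sinKer t) f - kerOp muJ (sinKer t) (idF * f) =
      π⁻¹ • (ip (cosF t) f • sinF t - ip (sinF t) f • cosF t) := by
    ext u
    simp only [ContinuousMap.sub_apply, ContinuousMap.mul_apply, ContinuousMap.smul_apply,
      kerOp_apply, pairing_apply, smul_eq_mul, ← integral_const_mul, ← integral_mul_const]
    rw [← integral_sub (integrable_of_continuous (by fun_prop))
      (integrable_of_continuous (by fun_prop)), ← integral_sub
      (integrable_of_continuous (by fun_prop)) (integrable_of_continuous (by fun_prop)),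
      ← integral_const_mul]
    congr 1 with v
    -- The commutator has kernel `(u - v) K(u, v) = sin (π t (u - v)) / π`, and the addition formula
    -- splits it into rank two.
    have h1 := mul_kap t (u - v)
    rw [mul_sub, sin_sub] at h1
    simp only [sinKer_apply, idF_apply, cosF_apply, sinF_apply]
    linear_combination f v * h1
  rw [opA_apply, opA_apply, mul_sub, mul_smul_comm, div_eq_mul_inv, mul_smul, ← key, smul_sub]
  abel

theorem inv_mul_idF (h : IsUnit (opA lam t)) (f : C(J, ℝ)) :
    inv lam t (idF * f) = idF * inv lam t f -
      (lam / π) • (ip (cosF t) (inv lam t f) • Q lam t - ip (sinF t) (inv lam t f) • P lam t) := by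
  have h1 := congrArg (inv lam t) (opA_mul_idF (lam := lam) (t := t) (inv lam t f))
  rw [inv_opA h, opA_inv h, map_add, map_smul, map_sub, map_smul, map_smul] at h1
  exact eq_sub_of_add_eq h1.symm

end Fixed

/-! ### Differentiation in the length parameter -/

section Deriv

variable {lam t : ℝ}

theorem hasDerivAt_opA (lam t : ℝ) :
    HasDerivAt (opA lam) (-(lam • kerOp muJ (cosKer t))) t :=
  (((kerOp muJ).hasFDerivAt.comp_hasDerivAt t (hasDerivAt_sinKer t)).const_smul lam).const_sub
    (1 : C(J, ℝ) →L[ℝ] C(J, ℝ))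

theorem hasDerivAt_ringInverse {R : Type*} [NormedRing R] [NormedAlgebra ℝ R] [CompleteSpace R]
    {A : ℝ → R} {B : R} {c t : ℝ} (h : IsUnit (A t)) (hA : HasDerivAt A (-(c • B)) t) :
    HasDerivAt (fun s => Ring.inverse (A s))
      (c • (Ring.inverse (A t) * B * Ring.inverse (A t))) t := by
  obtain ⟨u, hu⟩ := h
  have h1 := hasFDerivAt_ringInverse (𝕜 := ℝ) u
  rw [hu] at h1
  have h2 := h1.comp_hasDerivAt t hA
  refine h2.congr_deriv ?_
  rw [← hu, Ring.inverse_unit]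
  simp

theorem hasDerivAt_inv (h : IsUnit (opA lam t)) :
    HasDerivAt (inv lam) (lam • (inv lam t * kerOp muJ (cosKer t) * inv lam t)) t := by
  exact hasDerivAt_ringInverse (R := C(J, ℝ) →L[ℝ] C(J, ℝ)) h (hasDerivAt_opA lam t)

/-- By self-adjointness of `A⁻¹`, its derivative `lam A⁻¹ K' A⁻¹` is `lam (P ⊗ P + Q ⊗ Q)`; here it
is written with the pairings against `cos` and `sin`. -/
theorem hasDerivAt_inv_apply (h : IsUnit (opA lam t)) {f : ℝ → C(J, ℝ)} {f' : C(J, ℝ)}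
    (hf : HasDerivAt f f' t) :
    HasDerivAt (fun s => inv lam s (f s)) (inv lam t f' +
      lam • (ip (cosF t) (inv lam t (f t)) • P lam t +
        ip (sinF t) (inv lam t (f t)) • Q lam t)) t := by
  refine ((hasDerivAt_inv h).clm_apply hf).congr_deriv ?_
  rw [add_comm]
  simp [kerOp_cosKer, mul_apply_eq_comp, P, Q]

/-- `∫ sin (π t u) Q(u) du`. -/
noncomputable def aF (lam t : ℝ) : ℝ := ip (sinF t) (Q lam t)

/-- `∫ cos (π t u) P(u) du`. -/
noncomputable def bF (lam t : ℝ) : ℝ := ip (cosF t) (P lam t)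

theorem ip_sinF_Q : ip (sinF t) (Q lam t) = aF lam t := rfl

theorem ip_cosF_P : ip (cosF t) (P lam t) = bF lam t := rfl

theorem inv_idF_cosF (h : IsUnit (opA lam t)) :
    inv lam t (idF * cosF t) = idF * P lam t - (lam / π * bF lam t) • Q lam t := by
  rw [inv_mul_idF h, ← P, ip_sinF_P h, ← bF, zero_smul, sub_zero, smul_smul]

theorem inv_idF_sinF (h : IsUnit (opA lam t)) :
    inv lam t (idF * sinF t) = idF * Q lam t + (lam / π * aF lam t) • P lam t := by
  rw [inv_mul_idF h, ← Q, ip_cosF_Q h, ← aF, zero_smul, zero_sub, smul_neg, sub_neg_eq_add,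
    smul_smul]

/-- The two contributions to the coefficient are `lam a`, from differentiating `A⁻¹`, and `-lam b`,
from moving the coordinate through `A⁻¹`. Parity kills the mixed pairings. For `P` the roles of `a`
and `b` are exchanged. -/
theorem hasDerivAt_Q (h : IsUnit (opA lam t)) :
    HasDerivAt (Q lam) (π • (idF * P lam t) + (lam * (aF lam t - bF lam t)) • Q lam t) t := by
  refine (hasDerivAt_inv_apply h (hasDerivAt_sinF t)).congr_deriv ?_
  rw [map_smul, inv_idF_cosF h, ← Q, ip_cosF_Q h, ← aF]
  ext u
  simp only [ContinuousMap.add_apply, ContinuousMap.sub_apply, ContinuousMap.smul_apply,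
    ContinuousMap.mul_apply, smul_eq_mul]
  field_simp
  ring

theorem hasDerivAt_P (h : IsUnit (opA lam t)) :
    HasDerivAt (P lam) (-(π • (idF * Q lam t)) - (lam * (aF lam t - bF lam t)) • P lam t) t := by
  refine (hasDerivAt_inv_apply h (hasDerivAt_cosF t)).congr_deriv ?_
  rw [map_neg, map_smul, inv_idF_sinF h, ← P, ip_sinF_P h, ← bF]
  ext u
  simp only [ContinuousMap.add_apply, ContinuousMap.sub_apply, ContinuousMap.smul_apply,
    ContinuousMap.mul_apply, ContinuousMap.neg_apply, smul_eq_mul]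
  field_simp
  ring

theorem hasDerivAt_aF (h : IsUnit (opA lam t)) :
    HasDerivAt (aF lam) (π * (ip (idF * cosF t) (Q lam t) + ip (idF * sinF t) (P lam t)) +
      lam * (aF lam t - bF lam t) * aF lam t) t := by
  have := ip.hasDerivAt_of_bilinear (fun _ => hasDerivAt_sinF t) (fun _ => hasDerivAt_Q h)
  refine this.congr_deriv ?_
  have h1 : ip (sinF t) (idF * P lam t) = ip (idF * sinF t) (P lam t) := by
    simp only [pairing_apply, ContinuousMap.mul_apply]
    congr 1 with u
    ring
  simp only [map_smul, map_add, _root_.smul_apply, smul_eq_mul, h1, ip_sinF_Q]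
  ring

theorem hasDerivAt_bF (h : IsUnit (opA lam t)) :
    HasDerivAt (bF lam) (-π * (ip (idF * cosF t) (Q lam t) + ip (idF * sinF t) (P lam t)) -
      lam * (aF lam t - bF lam t) * bF lam t) t := by
  have := ip.hasDerivAt_of_bilinear (fun _ => hasDerivAt_cosF t) (fun _ => hasDerivAt_P h)
  refine this.congr_deriv ?_
  have h1 : ip (cosF t) (idF * Q lam t) = ip (idF * cosF t) (Q lam t) := by
    simp only [pairing_apply, ContinuousMap.mul_apply]
    congr 1 with u
    ring
  simp only [map_smul, map_neg, map_sub, _root_.smul_apply, _root_.neg_apply, smul_eq_mul,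
    h1, ip_cosF_P]
  ring

/-- The pairings that contain the coordinate enter `a'` and `b'` with opposite signs and cancel in
the sum. -/
theorem hasDerivAt_aF_add_bF (h : IsUnit (opA lam t)) :
    HasDerivAt (fun s => aF lam s + bF lam s) (lam * (aF lam t - bF lam t) ^ 2) t :=
  ((hasDerivAt_aF h).add (hasDerivAt_bF h)).congr_deriv (by ring)

end Deriv

/-! ### Differentiation in the space variable and integration by parts -/

theorem integral_cosF (x : ℝ) : ∫ u, cosF x u ∂muJ = 2 * sinc (π * x) := by
  rcases eq_or_ne x 0 with rfl | hx
  · have h := integral_muJ fun u => cos (π * 0 * u)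
    simp only [cosF_apply, h]
    norm_num
  · have hc : π * x ≠ 0 := mul_ne_zero pi_pos.ne' hx
    have h := integral_muJ fun u => cos (π * x * u)
    simp only [cosF_apply, h]
    have h2 := intervalIntegral.mul_integral_comp_mul_left (a := -1) (b := 1) (f := cos) (π * x)
    rw [integral_cos, mul_neg, mul_one, sin_neg, ← sinc_mul_self] at h2
    apply mul_left_cancel₀ hc
    linarith

/-- Writing the kernel as an average of cosines makes it differentiable in `w` without a separate
treatment of the removable singularity at `0`. -/
theorem kap_eq (t w : ℝ) : kap t w = t / 2 * ip 1 (cosF (t * w)) := by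
  have : ip 1 (cosF (t * w)) = ∫ u, cosF (t * w) u ∂muJ := by simp [pairing_apply]
  rw [this, integral_cosF, kap, mul_assoc π]
  ring

/-- The derivative of `kap t`. -/
noncomputable def kapDeriv (t w : ℝ) : ℝ :=
  t / 2 * (ip 1 (-(π • (idF * sinF (t * w)))) * t)

theorem hasDerivAt_kap_right (t w : ℝ) : HasDerivAt (kap t) (kapDeriv t w) w := by
  have h1 : kap t = fun w => t / 2 * ip 1 (cosF (t * w)) := funext (kap_eq t)
  rw [h1]
  have h2 : HasDerivAt (fun s => ip 1 (cosF s)) (ip 1 (-(π • (idF * sinF (t * w))))) (t * w) :=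
    (ip 1).hasFDerivAt.comp_hasDerivAt (t * w) (hasDerivAt_cosF (t * w))
  have h3 : HasDerivAt (fun w => t * w) t w := by simpa using! (hasDerivAt_id w).const_mul t
  exact (h2.comp w h3).const_mul (t / 2)

theorem continuous_kapDeriv (t : ℝ) : Continuous (kapDeriv t) := by
  have h : Continuous fun w => -(π • (idF * sinF (t * w))) :=
    ((continuous_const.mul (continuous_sinF.comp (continuous_const.mul continuous_id))).const_smul
      π).neg
  exact continuous_const.mul (((ip 1).continuous.comp h).mul continuous_const)

/-- `f'` is the restriction to `[-1, 1]` of the continuous derivative of an extension of `f`. -/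
def HasDerivExt (f f' : C(J, ℝ)) : Prop :=
  ∃ F F' : ℝ → ℝ, (∀ u, HasDerivAt F (F' u) u) ∧ Continuous F' ∧
    ∀ u : J, F u = f u ∧ F' u = f' u

/-- The right end point of `[-1, 1]`. -/
def oneJ : J := ⟨1, by norm_num⟩

@[simp] theorem coe_oneJ : ((oneJ : J) : ℝ) = 1 := rfl

namespace HasDerivExt

variable {f f' g g' : C(J, ℝ)}

theorem mul (hf : HasDerivExt f f') (hg : HasDerivExt g g') :
    HasDerivExt (f * g) (f' * g + f * g') := by
  obtain ⟨F, F', h1, h2, h3⟩ := hf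
  obtain ⟨G, G', h4, h5, h6⟩ := hg
  have cF : Continuous F := continuous_iff_continuousAt.2 fun u => (h1 u).continuousAt
  have cG : Continuous G := continuous_iff_continuousAt.2 fun u => (h4 u).continuousAt
  exact ⟨fun u => F u * G u, fun u => F' u * G u + F u * G' u, fun u => (h1 u).mul (h4 u),
    by fun_prop, fun u => by simp [h3, h6]⟩

theorem sub (hf : HasDerivExt f f') (hg : HasDerivExt g g') :
    HasDerivExt (f - g) (f' - g') := by
  obtain ⟨F, F', h1, h2, h3⟩ := hf
  obtain ⟨G, G', h4, h5, h6⟩ := hg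
  exact ⟨fun u => F u - G u, fun u => F' u - G' u, fun u => (h1 u).sub (h4 u),
    by fun_prop, fun u => by simp [h3, h6]⟩

theorem smul (c : ℝ) (hf : HasDerivExt f f') : HasDerivExt (c • f) (c • f') := by
  obtain ⟨F, F', h1, h2, h3⟩ := hf
  exact ⟨fun u => c * F u, fun u => c * F' u, fun u => (h1 u).const_mul c,
    by fun_prop, fun u => by simp [h3]⟩

theorem unique (hf : HasDerivExt f f') (hg : HasDerivExt f g') : f' = g' := by
  obtain ⟨F, F', h1, -, h3⟩ := hf
  obtain ⟨G, G', h4, -, h6⟩ := hg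
  ext u
  rw [← (h3 u).2, ← (h6 u).2]
  refine (uniqueDiffOn_Icc (by norm_num : (-1 : ℝ) < 1) u u.2).eq_deriv _
    (h1 u).hasDerivWithinAt ?_
  refine (h4 u).hasDerivWithinAt.congr (fun v hv => ?_) ?_
  · rw [(h3 ⟨v, hv⟩).1, ← (h6 ⟨v, hv⟩).1]
  · rw [(h3 u).1, ← (h6 u).1]

theorem integral_eq (hf : HasDerivExt f f') :
    ∫ u, f' u ∂muJ = f oneJ - f (negJ oneJ) := by
  obtain ⟨F, F', h1, h2, h3⟩ := hf
  simp only [← (h3 _).1, ← (h3 _).2]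
  rw [integral_muJ F', intervalIntegral.integral_eq_sub_of_hasDerivAt (fun u _ => h1 u)
    (h2.intervalIntegrable _ _)]
  rfl

theorem ip_eq (hf : HasDerivExt f f') (hg : HasDerivExt g g') :
    ip f g' = f oneJ * g oneJ - f (negJ oneJ) * g (negJ oneJ) - ip f' g := by
  have h := (hf.mul hg).integral_eq
  simp only [ContinuousMap.add_apply, ContinuousMap.mul_apply] at h
  rw [integral_add (integrable_of_continuous (by fun_prop))
    (integrable_of_continuous (by fun_prop))] at h
  rw [pairing_apply, pairing_apply]
  linarith

end HasDerivExt

theorem hasDerivExt_sinF (t : ℝ) : HasDerivExt (sinF t) ((π * t) • cosF t) := by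
  refine ⟨fun u => sin (π * t * u), fun u => π * t * cos (π * t * u), fun u => ?_, by fun_prop,
    fun u => by simp⟩
  refine (((hasDerivAt_id u).const_mul (π * t)).sin).congr_deriv ?_
  simp
  ring

theorem hasDerivExt_cosF (t : ℝ) : HasDerivExt (cosF t) (-((π * t) • sinF t)) := by
  refine ⟨fun u => cos (π * t * u), fun u => -(π * t * sin (π * t * u)), fun u => ?_, by fun_prop,
    fun u => by simp⟩
  refine (((hasDerivAt_id u).const_mul (π * t)).cos).congr_deriv ?_
  simp
  ring

theorem hasDerivExt_idF_sub (c : ℝ) : HasDerivExt (idF - c • 1) 1 :=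
  ⟨fun u => u - c, fun _ => 1, fun u => (hasDerivAt_id u).sub_const c, by fun_prop,
    fun u => by simp⟩

theorem hasDerivExt_idF : HasDerivExt idF 1 :=
  ⟨fun u => u, fun _ => 1, fun u => hasDerivAt_id u, by fun_prop, fun u => by simp⟩

/-- The section `lam K(·, y)` of the rescaled kernel. -/
noncomputable def ell (lam t : ℝ) (y : J) : C(J, ℝ) :=
  ⟨fun u => lam * kap t (u - y),
    continuous_const.mul ((continuous_kap t).comp (by fun_prop))⟩

theorem ell_apply (lam t : ℝ) (y u : J) : ell lam t y u = lam * kap t (u - y) := rfl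

section

variable {lam t : ℝ}

theorem hasDerivExt_ell (y : J) : ∃ f', HasDerivExt (ell lam t y) f' := by
  have hc := continuous_kapDeriv t
  refine ⟨⟨fun u => lam * kapDeriv t (u - y), by fun_prop⟩, fun u => lam * kap t (u - y),
    fun u => lam * kapDeriv t (u - y), fun u => ?_, by fun_prop, fun u => ⟨rfl, rfl⟩⟩
  have := (hasDerivAt_kap_right t (u - y)).comp u ((hasDerivAt_id u).sub_const (y : ℝ))
  simpa using! this.const_mul lam

theorem ip_ell (f : C(J, ℝ)) (y : J) : ip f (ell lam t y) = f y - opA lam t f y := by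
  simp only [opA_apply, ContinuousMap.sub_apply, ContinuousMap.smul_apply, sub_sub_cancel,
    kerOp_apply, pairing_apply, ell_apply, smul_eq_mul, ← integral_const_mul]
  congr 1 with v
  rw [sinKer_symm, sinKer_apply]
  ring

theorem hasDerivAt_kap_integral (f : C(J, ℝ)) (u : ℝ) :
    HasDerivAt (fun u : ℝ => ∫ v : J, kap t (u - v) * f v ∂muJ)
      (∫ v : J, kapDeriv t (u - v) * f v ∂muJ) u := by
  have ck := continuous_kap t
  have cd := continuous_kapDeriv t
  let c : ℝ → C(J, ℝ) := fun u => ⟨fun v => kap t (u - v), by fun_prop⟩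
  let c' : ℝ → C(J, ℝ) := fun u => ⟨fun v => kapDeriv t (u - v), by fun_prop⟩
  have hc' : Continuous c' := ContinuousMap.continuous_of_continuous_uncurry _
    (show Continuous fun p : ℝ × J => kapDeriv t (p.1 - p.2) by fun_prop)
  have h := hasDerivAt_continuousMap (F := c) hc' (fun u v => by
    have := (hasDerivAt_kap_right t (u - v)).comp u ((hasDerivAt_id u).sub_const (v : ℝ))
    simpa using! this) u
  have h2 : HasDerivAt (fun u => ip f (c u)) (ip f (c' u)) u :=
    (ip f).hasFDerivAt.comp_hasDerivAt u h
  simpa only [pairing_apply, c, c', ContinuousMap.coe_mk, mul_comm (f _)] using h2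

theorem continuous_kapDeriv_integral (f : C(J, ℝ)) :
    Continuous fun u : ℝ => ∫ v : J, kapDeriv t (u - v) * f v ∂muJ := by
  have cd := continuous_kapDeriv t
  exact continuous_integral (by fun_prop)

/-- The equation `f = g + lam K f` extends `f` smoothly beyond `[-1, 1]`, since its right side makes
sense for every real `u`. Because `K` depends on `u - v`, the `u`-derivative of the kernel is minus
its `v`-derivative, and integrating by parts moves it to `f` at the price of two end-point terms. -/
theorem exists_hasDerivExt_of_opA {f g g' : C(J, ℝ)} (hfg : opA lam t f = g)
    (hg : HasDerivExt g g') :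
    ∃ f', HasDerivExt f f' ∧ opA lam t f' =
      g' - f oneJ • ell lam t oneJ + f (negJ oneJ) • ell lam t (negJ oneJ) := by
  obtain ⟨G, G', h1, h2, h3⟩ := hg
  let F : ℝ → ℝ := fun u => G u + lam * ∫ v : J, kap t (u - v) * f v ∂muJ
  let F' : ℝ → ℝ := fun u => G' u + lam * ∫ v : J, kapDeriv t (u - v) * f v ∂muJ
  have hF : ∀ u, HasDerivAt F (F' u) u := fun u =>
    (h1 u).add ((hasDerivAt_kap_integral f u).const_mul lam)
  have cF' : Continuous F' := h2.add (continuous_const.mul (continuous_kapDeriv_integral f))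
  have hFf : ∀ u : J, F u = f u := fun u => by
    have := DFunLike.congr_fun hfg u
    rw [opA_apply] at this
    simp only [F, (h3 u).1, ← this]
    simp [kerOp_apply, sinKer_apply]
  let f' : C(J, ℝ) := ⟨fun u => F' u, by fun_prop⟩
  refine ⟨f', ⟨F, F', hF, cF', fun u => ⟨hFf u, rfl⟩⟩, ?_⟩
  ext u
  have hi : ∫ v : J, kapDeriv t (u - v) * f v ∂muJ =
      ∫ v in (-1 : ℝ)..1, kapDeriv t (u - v) * F v := by
    simp only [← hFf]
    exact integral_muJ fun v => kapDeriv t (u - v) * F v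
  have hk : ∫ v : J, kap t (u - v) * f' v ∂muJ = ∫ v in (-1 : ℝ)..1, kap t (u - v) * F' v :=
    integral_muJ fun v => kap t (u - v) * F' v
  have hd : ∀ v : ℝ, HasDerivAt (fun v => kap t (u - v)) (-kapDeriv t (u - v)) v := fun v => by
    have := (hasDerivAt_kap_right t (u - v)).comp v ((hasDerivAt_id v).const_sub (u : ℝ))
    simpa using! this
  have cd := continuous_kapDeriv t
  have hp := intervalIntegral.integral_mul_deriv_eq_deriv_mul (a := -1) (b := 1)
    (fun v _ => hd v) (fun v _ => hF v)
    (Continuous.intervalIntegrable (by fun_prop) _ _) (cF'.intervalIntegrable _ _)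
  simp only [neg_mul, intervalIntegral.integral_neg] at hp
  have e1 : F 1 = f oneJ := hFf oneJ
  have e2 : F (-1) = f (negJ oneJ) := hFf (negJ oneJ)
  rw [← hk, ← hi, e1, e2] at hp
  simp only [opA_apply, ContinuousMap.sub_apply, ContinuousMap.add_apply, ContinuousMap.smul_apply,
    smul_eq_mul, ell_apply, kerOp_apply, sinKer_apply, coe_negJ, coe_oneJ, ← (h3 u).2]
  rw [hp]
  simp only [f', F', ContinuousMap.coe_mk]
  ring

end

/-! ### Relations between end-point values and inner products -/

variable {lam t : ℝ}

/-- The value of `Q` at the right end point. -/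
noncomputable def qF (lam t : ℝ) : ℝ := Q lam t oneJ

/-- The value of `P` at the right end point. -/
noncomputable def pF (lam t : ℝ) : ℝ := P lam t oneJ

theorem Q_oneJ : Q lam t oneJ = qF lam t := rfl

theorem P_oneJ : P lam t oneJ = pF lam t := rfl

theorem opA_Q (h : IsUnit (opA lam t)) : opA lam t (Q lam t) = sinF t := opA_inv h _

theorem opA_P (h : IsUnit (opA lam t)) : opA lam t (P lam t) = cosF t := opA_inv h _

theorem Q_negJ_oneJ (h : IsUnit (opA lam t)) : Q lam t (negJ oneJ) = -qF lam t := Q_negJ h oneJ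

theorem P_negJ_oneJ (h : IsUnit (opA lam t)) : P lam t (negJ oneJ) = pF lam t := P_negJ h oneJ

theorem exists_deriv_Q (h : IsUnit (opA lam t)) : ∃ f', HasDerivExt (Q lam t) f' ∧
    opA lam t f' = (π * t) • cosF t - qF lam t • (ell lam t oneJ + ell lam t (negJ oneJ)) := by
  obtain ⟨f', h1, h2⟩ := exists_hasDerivExt_of_opA (opA_Q h) (hasDerivExt_sinF t)
  refine ⟨f', h1, ?_⟩
  rw [h2, Q_negJ_oneJ h, ← qF]
  module

theorem exists_deriv_P (h : IsUnit (opA lam t)) : ∃ f', HasDerivExt (P lam t) f' ∧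
    opA lam t f' = -((π * t) • sinF t) - pF lam t • (ell lam t oneJ - ell lam t (negJ oneJ)) := by
  obtain ⟨f', h1, h2⟩ := exists_hasDerivExt_of_opA (opA_P h) (hasDerivExt_cosF t)
  refine ⟨f', h1, ?_⟩
  rw [h2, P_negJ_oneJ h, ← pF]
  module

theorem ip_Q_ell (h : IsUnit (opA lam t)) :
    ip (Q lam t) (ell lam t oneJ) = qF lam t - sin (π * t) := by
  simp [ip_ell, opA_Q h, qF]

theorem ip_Q_ell_neg (h : IsUnit (opA lam t)) :
    ip (Q lam t) (ell lam t (negJ oneJ)) = -(qF lam t - sin (π * t)) := by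
  simp [ip_ell, opA_Q h, Q_negJ_oneJ h]
  ring

theorem ip_P_ell (h : IsUnit (opA lam t)) :
    ip (P lam t) (ell lam t oneJ) = pF lam t - cos (π * t) := by
  simp [ip_ell, opA_P h, pF]

theorem ip_P_ell_neg (h : IsUnit (opA lam t)) :
    ip (P lam t) (ell lam t (negJ oneJ)) = pF lam t - cos (π * t) := by
  simp [ip_ell, opA_P h, P_negJ_oneJ h]

/-- Evaluate `⟨P, A Q'⟩ = ⟨cos, Q'⟩` in two ways, where `Q'` is the space derivative: the left side
by the commutator with `d/du`, the right side by parts. The boundary terms containing `cos (π t)`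
cancel. -/
theorem mul_aF_sub_bF (h : IsUnit (opA lam t)) :
    π * t * (aF lam t - bF lam t) = -2 * (pF lam t * qF lam t) := by
  obtain ⟨f', h1, h2⟩ := exists_deriv_Q h
  have h3 := (hasDerivExt_cosF t).ip_eq h1
  have h4 := ip_opA (lam := lam) (t := t) (P lam t) f'
  rw [opA_P h, h2] at h4
  simp only [map_sub, map_smul, map_add, smul_eq_mul, ip_P_ell h, ip_P_ell_neg h, Q_negJ_oneJ h,
    map_neg, _root_.neg_apply, _root_.smul_apply, ip_sinF_Q, cosF_apply, coe_negJ, coe_oneJ,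
    pairing_comm (P lam t) (cosF t), ip_cosF_P, mul_neg, cos_neg, mul_one, Q_oneJ] at h3 h4
  linear_combination -h4 - h3

theorem idF_mul_ell (y : J) : idF * ell lam t y = (y : ℝ) • ell lam t y +
    (lam / π) • (cos (π * t * y) • sinF t - sin (π * t * y) • cosF t) := by
  ext u
  have h1 := mul_kap t (u - y)
  rw [mul_sub, sin_sub] at h1
  simp only [ContinuousMap.mul_apply, ContinuousMap.add_apply, ContinuousMap.smul_apply,
    ContinuousMap.sub_apply, smul_eq_mul, idF_apply, ell_apply, sinF_apply, cosF_apply]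
  linear_combination lam * h1

theorem ip_mul_left (f g k : C(J, ℝ)) : ip f (g * k) = ip (g * f) k := by
  simp only [pairing_apply, ContinuousMap.mul_apply]
  congr 1 with u
  ring

/-- Self-adjointness moves `A⁻¹` from `sin` to `u cos`, and the rank-two correction there produces
the product `a b`. -/
theorem ip_idF_cosF_Q (h : IsUnit (opA lam t)) : ip (idF * cosF t) (Q lam t) =
    ip (idF * sinF t) (P lam t) - lam / π * (aF lam t * bF lam t) := by
  have h1 := ip_inv h (idF * cosF t) (sinF t)
  rw [← Q, inv_idF_cosF h] at h1
  rw [h1, map_sub, _root_.sub_apply, map_smul, _root_.smul_apply, smul_eq_mul,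
    pairing_comm (Q lam t), ip_sinF_Q, pairing_comm _ (sinF t), ip_mul_left]
  ring

/-- A virial identity: evaluate `⟨Q, A (u Q')⟩ = ⟨sin, u Q'⟩` in two ways, using both commutators on
the left and integration by parts on the right. `bF_eq` is the same computation for `P`. -/
theorem aF_eq (h : IsUnit (opA lam t)) :
    -aF lam t - 2 * (π * t) * ip (idF * cosF t) (Q lam t) =
      lam * t * aF lam t ^ 2 - 2 * qF lam t ^ 2 := by
  obtain ⟨f', h1, h2⟩ := exists_deriv_Q h
  have h3 := (hasDerivExt_idF.mul (hasDerivExt_sinF t)).ip_eq h1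
  have h4 := ip_opA (lam := lam) (t := t) (Q lam t) (idF * f')
  have h5 := (hasDerivExt_cosF t).ip_eq h1
  have h6 := (hasDerivExt_sinF t).ip_eq h1
  rw [opA_Q h, opA_mul_idF, h2, mul_sub, mul_smul_comm, mul_smul_comm, mul_add, idF_mul_ell,
    idF_mul_ell, ip_mul_left] at h4
  simp only [map_sub, map_smul, map_add, smul_eq_mul, ip_Q_ell h, ip_Q_ell_neg h, Q_negJ_oneJ h,
    map_neg, _root_.neg_apply, _root_.smul_apply, _root_.add_apply, ip_sinF_Q, cosF_apply,
    sinF_apply, coe_negJ, coe_oneJ, mul_smul_comm, one_mul, ContinuousMap.mul_apply, idF_apply,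
    pairing_comm (Q lam t) (sinF t), mul_neg, cos_neg, sin_neg, mul_one, Q_oneJ,
    pairing_comm (Q lam t) (cosF t), ip_cosF_Q h, pairing_comm (Q lam t) (idF * cosF t)]
    at h3 h4 h5 h6
  rw [h3, h5] at h4
  have h7 : lam / π * π = lam := div_mul_cancel₀ _ pi_pos.ne'
  linear_combination -h4 + t * aF lam t ^ 2 * h7

theorem bF_eq (h : IsUnit (opA lam t)) :
    -bF lam t + 2 * (π * t) * ip (idF * sinF t) (P lam t) =
      lam * t * bF lam t ^ 2 - 2 * pF lam t ^ 2 := by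
  obtain ⟨f', h1, h2⟩ := exists_deriv_P h
  have h3 := (hasDerivExt_idF.mul (hasDerivExt_cosF t)).ip_eq h1
  have h4 := ip_opA (lam := lam) (t := t) (P lam t) (idF * f')
  have h6 := (hasDerivExt_sinF t).ip_eq h1
  rw [opA_P h, opA_mul_idF, h2, mul_sub, mul_neg, mul_smul_comm, mul_smul_comm, mul_sub,
    idF_mul_ell, idF_mul_ell, ip_mul_left] at h4
  simp only [map_sub, map_smul, map_add, smul_eq_mul, ip_P_ell h, ip_P_ell_neg h, P_negJ_oneJ h,
    map_neg, _root_.neg_apply, _root_.smul_apply, _root_.add_apply, cosF_apply,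
    sinF_apply, coe_negJ, coe_oneJ, mul_smul_comm, one_mul, ContinuousMap.mul_apply, idF_apply,
    pairing_comm (P lam t) (cosF t), ip_cosF_P, mul_neg, cos_neg, sin_neg, mul_one, P_oneJ,
    ip_P_sinF h, pairing_comm (P lam t) (idF * sinF t)] at h3 h4 h6
  rw [h3, h6] at h4
  have h7 : lam / π * π = lam := div_mul_cancel₀ _ pi_pos.ne'
  linear_combination -h4 + t * bF lam t ^ 2 * h7

/-- Adding the two virial identities leaves only a difference of pairings containing the coordinate,
which `ip_idF_cosF_Q` evaluates; its `a b` completes the square `(a - b)²`. -/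
theorem aF_add_bF_eq (h : IsUnit (opA lam t)) : aF lam t + bF lam t =
    2 * (pF lam t ^ 2 + qF lam t ^ 2) - t * lam * (aF lam t - bF lam t) ^ 2 := by
  have h7 : lam / π * π = lam := div_mul_cancel₀ _ pi_pos.ne'
  linear_combination -aF_eq h - bF_eq h - 2 * (π * t) * ip_idF_cosF_Q h +
    2 * t * (aF lam t * bF lam t) * h7

/-- The section `R(·, 1)` of the rescaled resolvent kernel. -/
noncomputable def G (lam t : ℝ) : C(J, ℝ) := inv lam t (ell lam t oneJ)

theorem opA_G (h : IsUnit (opA lam t)) : opA lam t (G lam t) = ell lam t oneJ := opA_inv h _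

theorem inv_ell_neg (h : IsUnit (opA lam t)) :
    inv lam t (ell lam t (negJ oneJ)) = (G lam t).comp negJ := by
  have h1 : ell lam t (negJ oneJ) = (ell lam t oneJ).comp negJ := by
    ext u
    rw [ContinuousMap.comp_apply, ell_apply, ell_apply, ← kap_neg]
    congr 2
    simp
    ring
  rw [h1, inv_comp_negJ h, G]

/-- The integrable form of the resolvent kernel, `(u - 1) R(u, 1) = (lam / π)(p Q(u) - q P(u))`,
obtained by applying `A` to both sides. -/
theorem idF_sub_mul_G (h : IsUnit (opA lam t)) : (idF - (1 : ℝ) • 1) * G lam t =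
    (lam / π) • (pF lam t • Q lam t - qF lam t • P lam t) := by
  have h1 := opA_mul_idF (lam := lam) (t := t) (G lam t)
  have h2 : ip (cosF t) (G lam t) = pF lam t - cos (π * t) := by
    rw [← ip_P_ell h]
    exact ip_inv h _ _
  have h3 : ip (sinF t) (G lam t) = qF lam t - sin (π * t) := by
    rw [← ip_Q_ell h]
    exact ip_inv h _ _
  rw [opA_G h, idF_mul_ell, h2, h3, coe_oneJ, mul_one] at h1
  have h4 : opA lam t ((idF - (1 : ℝ) • 1) * G lam t) =
      (lam / π) • (pF lam t • sinF t - qF lam t • cosF t) := by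
    rw [sub_mul, smul_mul_assoc, one_mul, map_sub, map_smul, h1, opA_G h]
    module
  rw [← inv_opA h ((idF - (1 : ℝ) • 1) * G lam t), h4]
  simp only [map_smul, map_sub]
  rfl

theorem G_negJ_oneJ (h : IsUnit (opA lam t)) :
    G lam t (negJ oneJ) = lam / π * (pF lam t * qF lam t) := by
  have h1 := DFunLike.congr_fun (idF_sub_mul_G h) (negJ oneJ)
  simp [Q_negJ_oneJ h, P_negJ_oneJ h] at h1
  linear_combination (-1 / 2) * h1

/-- At `u = 1` the integrable form reads `0 = 0`, so it is differentiated there: `R(1, 1) = (lam /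
π)(p Q'(1) - q P'(1))`. In this combination the `R(1, 1)` terms from `Q'` and `P'` cancel, and
`R(-1, 1)` remains, known from the integrable form at `u = -1`. -/
theorem G_oneJ (h : IsUnit (opA lam t)) :
    2 * G lam t oneJ = lam * t * (aF lam t + bF lam t) := by
  obtain ⟨e', he'⟩ := hasDerivExt_ell (lam := lam) (t := t) oneJ
  obtain ⟨g', hg', -⟩ := exists_hasDerivExt_of_opA (opA_G h) he'
  obtain ⟨f', h1, h2⟩ := exists_deriv_Q h
  obtain ⟨k', h3, h4⟩ := exists_deriv_P h
  have h5 := (hasDerivExt_idF_sub 1).mul hg'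
  rw [idF_sub_mul_G h] at h5
  have h6 := h5.unique (((h1.smul (pF lam t)).sub (h3.smul (qF lam t))).smul (lam / π))
  have h7 := DFunLike.congr_fun h6 oneJ
  have h8 : f' = (π * t) • P lam t - qF lam t • (G lam t + (G lam t).comp negJ) := by
    rw [← inv_opA h f', h2, ← inv_ell_neg h]
    simp only [map_sub, map_smul, map_add]
    rfl
  have h9 : k' = -((π * t) • Q lam t) - pF lam t • (G lam t - (G lam t).comp negJ) := by
    rw [← inv_opA h k', h4, ← inv_ell_neg h]
    simp only [map_sub, map_smul, map_neg]
    rfl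
  rw [h8, h9] at h7
  simp [G_negJ_oneJ h, P_oneJ, Q_oneJ] at h7
  have h10 : lam / π * π = lam := div_mul_cancel₀ _ pi_pos.ne'
  have h11 := mul_aF_sub_bF h
  have h12 := aF_add_bF_eq h
  have h13 : t * (aF lam t - bF lam t) = -2 * (pF lam t * qF lam t) / π := by
    rw [← h11]; field_simp
  have h14 : lam * t * (t * lam * (aF lam t - bF lam t) ^ 2) =
      (lam / π * (-2 * (pF lam t * qF lam t))) ^ 2 := by
    rw [div_mul_eq_mul_div, mul_div_assoc, ← h13]
    ring
  linear_combination 2 * h7 - lam * t * h12 + h14 +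
    2 * t * (pF lam t ^ 2 + qF lam t ^ 2) * h10

/-! ### The determinant as a function of the length -/

section Determinant

variable {lam t : ℝ}

theorem abs_sinKer_le (p : J × J) : |sinKer t p| ≤ |t| := by
  change |t * sinc _| ≤ |t|
  rw [abs_mul]
  exact mul_le_of_le_one_right (abs_nonneg t) (abs_sinc_le_one _)

theorem abs_cosKer_le (p : J × J) : |cosKer t p| ≤ 1 := by
  have : cosKer t p = cos (π * t * p.1 - π * t * p.2) := by rw [cos_sub]; rfl
  rw [this]
  exact abs_cos_le_one _

/-- The Fredholm determinant of the rescaled kernel. -/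
noncomputable def detF (lam t : ℝ) : ℝ := kerDet muJ (sinKer t) lam

theorem hasDerivAt_detF_minor (lam t : ℝ) : HasDerivAt (detF lam)
    (-lam * (detF lam t * ∫ x, cosKer t (x, x) ∂muJ + lam *
      ∫ p : J × J, cosKer t p * minorKer muJ (sinKer t) lam (p.2, p.1) ∂(muJ.prod muJ))) t := by
  refine hasDerivAt_fredDet (k := fun t x y => sinKer t (x, y)) (k' := fun t x y => cosKer t (x, y))
    (B := |t| + 1) (U := Ioo (t - 1) (t + 1)) isOpen_Ioo isPreconnected_Ioo
    (fun t => by fun_prop) (fun t => by fun_prop) (fun t x y => hasDerivAt_kap_sub t (x, y))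
    (fun s hs x y => (abs_sinKer_le _).trans ?_)
    (fun s hs x y => (abs_cosKer_le _).trans ?_) (by positivity) lam ⟨by linarith, by linarith⟩
  · have : |s - t| ≤ 1 := abs_le.2 ⟨by linarith [hs.1], by linarith [hs.2]⟩
    have h2 := abs_add_le (s - t) t
    rw [sub_add_cancel] at h2
    linarith
  · linarith [abs_nonneg t]

theorem continuous_detF (lam : ℝ) : Continuous (detF lam) :=
  continuous_iff_continuousAt.2 fun t => (hasDerivAt_detF_minor lam t).continuousAt

/-- The hypothesis is invertibility of `A`, not `D ≠ 0`; this makes the equation usable in proving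
that `D` has no zero. -/
theorem hasDerivAt_detF (h : IsUnit (opA lam t)) :
    HasDerivAt (detF lam) (-lam * (aF lam t + bF lam t) * detF lam t) t := by
  refine (hasDerivAt_detF_minor lam t).congr_deriv ?_
  have := deriv_fredDet_eq h (cosF t) (sinF t)
  change detF lam t * ∫ x, cosKer t (x, x) ∂muJ + lam *
      ∫ p : J × J, cosKer t p * minorKer muJ (sinKer t) lam (p.2, p.1) ∂(muJ.prod muJ) =
    detF lam t * (bF lam t + aF lam t) at this
  rw [this]
  ring

theorem detF_zero (lam : ℝ) : detF lam 0 = 1 := by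
  rw [detF, kerDet, fredDet, tsum_eq_single 0]
  · simp [detCoeff_zero]
  · intro n hn
    obtain ⟨n, rfl⟩ := Nat.exists_eq_succ_of_ne_zero hn
    have : ∀ w : Fin (n + 1) → J, (kerMat (fun x y => sinKer 0 (x, y)) w w).det = 0 := fun w =>
      Matrix.det_eq_zero_of_row_eq_zero 0 fun j => by simp [kerMat, sinKer_zero]
    simp [detCoeff, this]

theorem isUnit_of_detF_ne_zero (h : detF lam t ≠ 0) : IsUnit (opA lam t) :=
  isUnit_one_sub_kerOp (sinKer_symm t) h

end Determinant

/-! ### Fourier energy and the absence of eigenfunctions for `lam ≤ 1` -/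

section Energy

/-- The squared modulus of the Fourier transform of `f` at frequency `s / 2`. -/
noncomputable def energy (f : C(J, ℝ)) (s : ℝ) : ℝ := ip (cosF s) f ^ 2 + ip (sinF s) f ^ 2

variable {f : C(J, ℝ)}

theorem energy_nonneg (s : ℝ) : 0 ≤ energy f s := by unfold energy; positivity

theorem continuous_ip_cosF : Continuous fun s => ip (cosF s) f := by
  have := (ip f).continuous.comp continuous_cosF
  simpa only [pairing_comm _ f] using! this

theorem continuous_ip_sinF : Continuous fun s => ip (sinF s) f := by
  have := (ip f).continuous.comp continuous_sinF
  simpa only [pairing_comm _ f] using! this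

theorem continuous_energy : Continuous (energy f) :=
  (continuous_ip_cosF.pow 2).add (continuous_ip_sinF.pow 2)

theorem energy_neg (s : ℝ) : energy f (-s) = energy f s := by
  have h1 : cosF (-s) = cosF s := by ext u; simp
  have h2 : sinF (-s) = -sinF s := by ext u; simp
  rw [energy, energy, h1, h2, map_neg, _root_.neg_apply, neg_sq]

theorem kerOp_sinKer_eq_integral (t : ℝ) :
    kerOp muJ (sinKer t) f =
      ∫ s in (0 : ℝ)..t, (ip (cosF s) f • cosF s + ip (sinF s) f • sinF s) := by
  simp only [← kerOp_cosKer]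
  rw [sinKer_eq_integral]
  exact (((ContinuousLinearMap.apply ℝ C(J, ℝ) f).comp (kerOp muJ)).intervalIntegral_comp_comm
    (continuous_cosKer.intervalIntegrable 0 t)).symm

/-- The kernel vanishes at `t = 0` and its `t`-derivative is `c ⊗ c + s ⊗ s`, so its quadratic form
is the energy integrated over a band. -/
theorem ip_kerOp_sinKer (t : ℝ) :
    ip f (kerOp muJ (sinKer t) f) = ∫ s in (0 : ℝ)..t, energy f s := by
  rw [kerOp_sinKer_eq_integral]
  have hc : Continuous fun s => ip (cosF s) f • cosF s + ip (sinF s) f • sinF s :=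
    (continuous_ip_cosF.smul continuous_cosF).add (continuous_ip_sinF.smul continuous_sinF)
  rw [← (ip f).intervalIntegral_comp_comm (hc.intervalIntegrable 0 t)]
  congr 1 with s
  simp only [map_add, map_smul, smul_eq_mul, energy]
  rw [pairing_comm f, pairing_comm f]
  ring

theorem hasSum_energy (θ : ℝ) : HasSum (fun n : ℤ => energy f (n + θ)) (2 * ip f f) := by
  let F : ℝ → ℝ := fun x => f (projIcc (-1) 1 (by norm_num) x)
  have hF : Continuous F := f.continuous.comp continuous_projIcc
  have hfF : ∀ u : J, f u = F u := fun u => by simp [F]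
  -- The twist by `exp (-i π θ x)` shifts the integer frequencies of Fourier series on `(-1, 1)` by
  -- `θ`.
  let g : ℝ → ℂ := fun x => F x * Complex.exp (-(π * θ * x : ℝ) * Complex.I)
  have hg : Continuous g := by fun_prop
  have hng : ∀ x, ‖g x‖ = |F x| := fun x => by
    rw [norm_mul, ← Complex.ofReal_neg, Complex.norm_exp_ofReal_mul_I, mul_one,
      Complex.norm_real, Real.norm_eq_abs]
  have hL2 : MemLp g 2 (volume.restrict (Ioc (-1) 1)) :=
    MemLp.of_bound hg.aestronglyMeasurable ‖f‖
      (Eventually.of_forall fun x => by rw [hng]; exact f.norm_coe_le_norm _)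
  have h := hasSum_sq_fourierCoeffOn (by norm_num : (-1 : ℝ) < 1) hL2
  have hc (s : ℝ) : ip (cosF s) f = ∫ x in (-1 : ℝ)..1, cos (π * s * x) * F x := by
    rw [pairing_apply, ← integral_muJ fun x => cos (π * s * x) * F x]
    simp only [hfF, cosF_apply]
  have hs (s : ℝ) : ip (sinF s) f = ∫ x in (-1 : ℝ)..1, sin (π * s * x) * F x := by
    rw [pairing_apply, ← integral_muJ fun x => sin (π * s * x) * F x]
    simp only [hfF, sinF_apply]
  have h0 : ip f f = ∫ x in (-1 : ℝ)..1, F x * F x := by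
    rw [pairing_apply, ← integral_muJ fun x => F x * F x]
    simp only [hfF]
  have hco (n : ℤ) : fourierCoeffOn (by norm_num : (-1 : ℝ) < 1) g n =
      (1 / 2 : ℝ) • ((ip (cosF (n + θ)) f : ℂ) - Complex.I * (ip (sinF (n + θ)) f : ℂ)) := by
    rw [fourierCoeffOn_eq_integral, hc, hs, ← intervalIntegral.integral_ofReal,
      ← intervalIntegral.integral_ofReal, ← intervalIntegral.integral_const_mul,
      ← intervalIntegral.integral_sub (Continuous.intervalIntegrable (by fun_prop) _ _)
        (Continuous.intervalIntegrable (by fun_prop) _ _)]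
    congr 1
    · norm_num
    congr 1 with x
    rw [fourier_coe_apply, smul_eq_mul]
    simp only [g]
    rw [mul_left_comm, ← Complex.exp_add]
    have : (2 * π * Complex.I * ((-n : ℤ) : ℂ) * x / ((1 - -1 : ℝ) : ℂ) +
        -(π * θ * x : ℝ) * Complex.I) = ((-(π * (n + θ) * x) : ℝ) : ℂ) * Complex.I := by
      push_cast
      ring
    rw [this, Complex.exp_mul_I, ← Complex.ofReal_cos, ← Complex.ofReal_sin, cos_neg, sin_neg]
    push_cast
    ring
  -- The coefficients carry the factor `1 / 2` of a period of length two, so their squared norms are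
  -- a quarter of the energy.
  have h2 := h.mul_left 4
  convert! h2 using 1
  · ext n
    rw [hco, norm_smul, mul_pow, Complex.sq_norm, Complex.normSq_apply, energy]
    simp
    ring
  · simp only [hng, sq_abs, h0, smul_eq_mul, ← sq]
    ring

/-- Plancherel from Parseval: averaging the shifted Parseval identity over `θ` in `[0, 1]` covers
the real line, with total `2 ⟨f, f⟩`. Evenness of the energy halves this for the positive axis. -/
theorem integral_energy_le (N : ℕ) : ∫ s in (0 : ℝ)..N, energy f s ≤ ip f f := by
  have hI : ∀ a b : ℝ, IntervalIntegrable (energy f) volume a b := fun a b =>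
    continuous_energy.intervalIntegrable a b
  have h1 : ∀ θ : ℝ, ∑ n ∈ Finset.range N, (energy f (n + θ) + energy f (n + 1 - θ)) ≤
      2 * ip f f := fun θ => by
    -- The frequencies `n + θ` and `-(n + 1) + θ` are paired; by evenness the second counts as `n +
    -- 1 - θ`, which runs through the same unit interval.
    have h := (hasSum_energy (f := f) θ).nat_add_neg_add_one
    refine le_trans (Finset.sum_le_sum fun n _ => le_of_eq ?_)
      (sum_le_hasSum (Finset.range N) (fun n _ => add_nonneg (energy_nonneg _) (energy_nonneg _)) h)
    rw [← energy_neg (n + 1 - θ)]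
    push_cast
    congr 2
    ring
  have hc (n : ℕ) : Continuous fun θ => energy f (n + θ) + energy f (n + 1 - θ) :=
    (continuous_energy.comp (by fun_prop)).add (continuous_energy.comp (by fun_prop))
  have h2 := intervalIntegral.integral_mono_on (μ := volume) (a := 0) (b := 1) zero_le_one
    ((continuous_finsetSum (Finset.range N) fun n _ => hc n).intervalIntegrable 0 1)
    (intervalIntegrable_const (c := 2 * ip f f)) fun θ _ => h1 θ
  rw [intervalIntegral.integral_finsetSum fun n _ => (hc n).intervalIntegrable 0 1] at h2
  have h3 (n : ℕ) : ∫ θ in (0 : ℝ)..1, (energy f (n + θ) + energy f (n + 1 - θ)) =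
      2 * ∫ s in (n : ℝ)..(n + 1 : ℕ), energy f s := by
    have i1 : Continuous fun θ : ℝ => energy f (n + θ) := continuous_energy.comp (by fun_prop)
    have i2 : Continuous fun θ : ℝ => energy f (n + 1 - θ) := continuous_energy.comp (by fun_prop)
    rw [intervalIntegral.integral_add (i1.intervalIntegrable _ _) (i2.intervalIntegrable _ _),
      intervalIntegral.integral_comp_add_left, intervalIntegral.integral_comp_sub_left]
    push_cast
    simp
    ring
  simp only [h3, ← Finset.mul_sum] at h2
  rw [intervalIntegral.sum_integral_adjacent_intervals (a := fun n : ℕ => (n : ℝ))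
    fun k _ => hI _ _] at h2
  simp at h2
  linarith

/-- The Fourier transform of `f`, as a function of a complex frequency. -/
noncomputable def cft (f : C(J, ℝ)) (z : ℂ) : ℂ :=
  ∫ u : J, Complex.exp (Complex.I * (π * u : ℝ) * z) * f u ∂muJ

theorem differentiable_cft : Differentiable ℂ (cft f) := fun z => by
  have h (u : J) (z : ℂ) : HasDerivAt (fun z => Complex.exp (Complex.I * (π * u : ℝ) * z) * f u)
      (Complex.exp (Complex.I * (π * u : ℝ) * z) * (Complex.I * (π * u : ℝ)) * f u) z := by
    have := (((hasDerivAt_id z).const_mul (Complex.I * (π * u : ℝ))).cexp).mul_const (f u : ℂ)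
    simpa using! this
  refine (hasDerivAt_integral_of_dominated_loc_of_deriv_le (μ := muJ)
    (F := fun z (u : J) => Complex.exp (Complex.I * (π * u : ℝ) * z) * f u)
    (F' := fun z (u : J) =>
      Complex.exp (Complex.I * (π * u : ℝ) * z) * (Complex.I * (π * u : ℝ)) * f u)
    (bound := fun _ => rexp (π * (‖z‖ + 1)) * π * ‖f‖) (Metric.ball_mem_nhds z one_pos)
    (Eventually.of_forall fun w => Continuous.aestronglyMeasurable (by fun_prop))
    (Continuous.integrable_of_hasCompactSupport (by fun_prop) (HasCompactSupport.of_compactSpace _))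
    (Continuous.aestronglyMeasurable (by fun_prop))
    (Eventually.of_forall fun u w hw => ?_) (integrable_const _)
    (Eventually.of_forall fun u w _ => h u w)).2.differentiableAt
  have hu : |(u : ℝ)| ≤ 1 := abs_le.2 u.2
  have hw' : ‖w‖ ≤ ‖z‖ + 1 := by
    have := norm_sub_norm_le w z
    rw [Metric.mem_ball, dist_eq_norm] at hw
    linarith
  have hpu : ‖Complex.I * ((π * u : ℝ) : ℂ)‖ ≤ π := by
    rw [norm_mul, Complex.norm_I, one_mul, Complex.norm_real, norm_mul, Real.norm_eq_abs,
      Real.norm_eq_abs, abs_of_pos pi_pos]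
    exact mul_le_of_le_one_right pi_pos.le hu
  rw [norm_mul, norm_mul]
  gcongr
  · refine (Complex.norm_exp_le_exp_norm _).trans (Real.exp_le_exp.2 ?_)
    rw [norm_mul]
    gcongr
  · rw [Complex.norm_real]
    exact f.norm_coe_le_norm u

theorem cft_ofReal (s : ℝ) : cft f s = ip (cosF s) f + Complex.I * ip (sinF s) f := by
  have hi (g : C(J, ℝ)) : Integrable (fun u => ((g u * f u : ℝ) : ℂ)) muJ :=
    (integrable_of_continuous (f := fun u => g u * f u) (by fun_prop)).ofReal
  rw [pairing_apply, pairing_apply, ← integral_complex_ofReal, ← integral_complex_ofReal,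
    ← integral_const_mul, ← integral_add (hi _) ((hi _).const_mul _), cft]
  congr 1 with u
  have : Complex.I * (π * u : ℝ) * s = ((π * s * u : ℝ) : ℂ) * Complex.I := by push_cast; ring
  rw [this, Complex.exp_mul_I, ← Complex.ofReal_cos, ← Complex.ofReal_sin, cosF_apply, sinF_apply]
  push_cast
  ring

theorem energy_eq_zero_iff (s : ℝ) : energy f s = 0 ↔ cft f s = 0 := by
  rw [cft_ofReal, ← Complex.normSq_eq_zero, Complex.normSq_apply, energy]
  simp [sq]

/-- The Fourier transform of a function on a compact interval is entire, so vanishing on a real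
interval forces it to vanish identically. -/
theorem energy_eq_zero_of_Ioo {a b : ℝ} (hab : a < b) (h : ∀ s ∈ Ioo a b, energy f s = 0) (s : ℝ) :
    energy f s = 0 := by
  have han : AnalyticOnNhd ℂ (cft f) univ := differentiable_cft.differentiableOn.analyticOnNhd
    isOpen_univ
  let m : ℝ := (a + b) / 2
  have hm : m ∈ Ioo a b := ⟨by simp only [m]; linarith, by simp only [m]; linarith⟩
  have hfr : ∃ᶠ z in 𝓝[≠] (m : ℂ), cft f z = 0 := by
    have h1 : ∃ᶠ x : ℝ in 𝓝[≠] m, cft f (x : ℂ) = 0 := by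
      refine Eventually.frequently ?_
      filter_upwards [nhdsWithin_le_nhds (Ioo_mem_nhds hm.1 hm.2)] with x hx
      exact (energy_eq_zero_iff x).1 (h x hx)
    have h2 : Tendsto (fun x : ℝ => (x : ℂ)) (𝓝[≠] m) (𝓝[≠] (m : ℂ)) :=
      Complex.continuous_ofReal.continuousAt.continuousWithinAt.tendsto_nhdsWithin fun x hx => by
        simpa using hx
    exact h2.frequently h1
  exact (energy_eq_zero_iff s).2
    (han.eqOn_zero_of_preconnected_of_frequently_eq_zero isPreconnected_univ (mem_univ _) hfr
      (mem_univ _))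

theorem energy_eq_zero_of_integral {a b : ℝ} (hab : a < b) (h : ∫ s in a..b, energy f s ≤ 0) (s : ℝ) :
    energy f s = 0 := by
  refine energy_eq_zero_of_Ioo hab (fun x hx => ?_) s
  by_contra hne
  exact h.not_gt (intervalIntegral.integral_pos hab continuous_energy.continuousOn
    (fun x _ => energy_nonneg x)
    ⟨x, Ioo_subset_Icc_self hx, lt_of_le_of_ne (energy_nonneg x) (Ne.symm hne)⟩)

theorem eq_zero_of_opA_eq_zero {lam t : ℝ} (hlam : lam ≤ 1) (ht : 0 ≤ t)
    (hf : f = lam • kerOp muJ (sinKer t) f) : f = 0 := by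
  have h1 : ip f f = lam * ∫ s in (0 : ℝ)..t, energy f s := by
    nth_rw 2 [hf]
    rw [map_smul, ip_kerOp_sinKer, smul_eq_mul]
  have hI : ∀ a b : ℝ, IntervalIntegrable (energy f) volume a b := fun a b =>
    continuous_energy.intervalIntegrable a b
  have hpos : 0 ≤ ∫ s in (0 : ℝ)..t, energy f s :=
    intervalIntegral.integral_nonneg ht fun s _ => energy_nonneg s
  obtain ⟨N, hN⟩ := exists_nat_gt t
  have hB := integral_energy_le (f := f) N
  have hsplit := intervalIntegral.integral_add_adjacent_intervals (hI 0 t) (hI t N)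
  -- By the eigenvalue equation `∫_t^N ≤ ⟨f, f⟩ - ∫_0^t = (lam - 1) ∫_0^t ≤ 0`, so there is no
  -- energy between `t` and `N`.
  have hz : ∀ s, energy f s = 0 :=
    energy_eq_zero_of_integral hN (by nlinarith)
  have hc : ∀ s, ip (cosF s) f = 0 ∧ ip (sinF s) f = 0 := fun s => by
    have := hz s
    rw [energy] at this
    constructor <;> nlinarith [sq_nonneg (ip (cosF s) f), sq_nonneg (ip (sinF s) f)]
  rw [hf, kerOp_sinKer_eq_integral]
  simp [hc]

end Energy

/-! ### Compactness, invertibility and positivity -/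

section Compact

theorem isCompactOperator_smulRight (φ : C(J, ℝ) →L[ℝ] ℝ) (g : C(J, ℝ)) :
    IsCompactOperator (φ.smulRight g) :=
  (isCompactOperator_of_locallyCompactSpace_dom φ).clm_comp
    (ContinuousLinearMap.toSpanSingleton ℝ g)

theorem isCompactOperator_kerOp_cosKer (s : ℝ) : IsCompactOperator (kerOp muJ (cosKer s)) := by
  have h : kerOp muJ (cosKer s) =
      (ip (cosF s)).smulRight (cosF s) + (ip (sinF s)).smulRight (sinF s) := by
    ext1 f
    exact kerOp_cosKer s f
  rw [h]
  exact (isCompactOperator_smulRight _ _).add (isCompactOperator_smulRight _ _)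

theorem integral_mem_submodule {V : Type*} [NormedAddCommGroup V] [NormedSpace ℝ V]
    [CompleteSpace V] {S : Submodule ℝ V} (hS : IsClosed (S : Set V)) {f : ℝ → V}
    (hf : Continuous f) (h : ∀ s, f s ∈ S) (a b : ℝ) : ∫ s in a..b, f s ∈ S := by
  have : CompleteSpace S := hS.completeSpace_coe
  let g : ℝ → S := fun s => ⟨f s, h s⟩
  have hg : Continuous g := hf.subtype_mk _
  have h1 : ∫ s in a..b, f s = ((∫ s in a..b, g s : S) : V) :=
    S.subtypeL.intervalIntegral_comp_comm (hg.intervalIntegrable (μ := volume) a b)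
  rw [h1]
  exact (∫ s in a..b, g s : S).2

/-- The operator is a norm-convergent integral of rank-two operators, and the compact operators form
a closed subspace. -/
theorem isCompactOperator_kerOp_sinKer (t : ℝ) : IsCompactOperator (kerOp muJ (sinKer t)) := by
  have h2 : ∫ s in (0 : ℝ)..t, kerOp muJ (cosKer s) = kerOp muJ (∫ s in (0 : ℝ)..t, cosKer s) :=
    ContinuousLinearMap.intervalIntegral_comp_comm (𝕜 := ℝ) (E := C(J × J, ℝ))
      (F := C(J, ℝ) →L[ℝ] C(J, ℝ)) (kerOp muJ)
      (continuous_cosKer.intervalIntegrable (μ := volume) 0 t)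
  rw [sinKer_eq_integral, ← h2]
  exact integral_mem_submodule (V := C(J, ℝ) →L[ℝ] C(J, ℝ))
    (S := compactOperator (RingHom.id ℝ) C(J, ℝ) C(J, ℝ)) isClosed_setOfPred_isCompactOperator
    ((kerOp muJ).continuous.comp continuous_cosKer) isCompactOperator_kerOp_cosKer 0 t

theorem isUnit_opA {lam t : ℝ} (hlam : lam ≤ 1) (ht : 0 ≤ t) : IsUnit (opA lam t) := by
  have hc : IsCompactOperator (lam • kerOp muJ (sinKer t)) :=
    (isCompactOperator_kerOp_sinKer t).smul lam
  rcases hc.hasEigenvalue_or_mem_resolventSet (one_ne_zero (α := ℝ)) with h | h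
  · obtain ⟨f, hf⟩ := h.exists_hasEigenvector
    refine absurd (eq_zero_of_opA_eq_zero (f := f) hlam ht ?_) hf.2
    have := hf.apply_eq_smul
    rw [one_smul] at this
    exact this.symm
  · rw [spectrum.mem_resolventSet_iff, map_one] at h
    exact h

end Compact

/-- At a zero of `D`, the linear equation `D' = -lam (a + b) D`, whose coefficient is continuous
because `A` is invertible throughout, would force `D = 0` back to `t = 0`, against `D(0) = 1`. -/
theorem detF_pos {lam t : ℝ} (hlam : lam ≤ 1) (ht : 0 ≤ t) : 0 < detF lam t := by
  have hA : ContinuousOn (fun s => -lam * (aF lam s + bF lam s)) (Icc 0 t) := fun s hs =>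
    (((hasDerivAt_aF_add_bF (isUnit_opA hlam hs.1)).continuousAt).const_mul
      (-lam)).continuousWithinAt
  by_contra hneg
  rw [not_lt] at hneg
  obtain ⟨s, hs, hs0⟩ := intermediate_value_Icc' ht (continuous_detF lam).continuousOn
    (show (0 : ℝ) ∈ Icc (detF lam t) (detF lam 0) from ⟨hneg, by rw [detF_zero]; norm_num⟩)
  obtain ⟨C, hC⟩ := isCompact_Icc.exists_bound_of_continuousOn hA
  -- Time is reversed, since Grönwall's inequality propagates the zero at `s` forward in `r = s -
  -- t`.
  have hlip : ∀ r ∈ Ico 0 s, HasDerivWithinAt (fun r => detF lam (s - r))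
      (-(-lam * (aF lam (s - r) + bF lam (s - r)) * detF lam (s - r))) (Ici r) r := fun r hr => by
    have h1 := hasDerivAt_detF (isUnit_opA hlam (show 0 ≤ s - r by linarith [hr.2]))
    have h2 := h1.comp r ((hasDerivAt_id r).const_sub s)
    simpa using! h2.hasDerivWithinAt
  have hg := norm_le_gronwallBound_of_norm_deriv_right_le (f := fun r => detF lam (s - r))
    (δ := 0) (K := C) (ε := 0) (a := 0) (b := s)
    ((continuous_detF lam).comp (by fun_prop)).continuousOn hlip (by simp [hs0])
    (fun r hr => by
      rw [norm_neg, norm_mul, add_zero]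
      exact mul_le_mul_of_nonneg_right
        (hC (s - r) ⟨by linarith [hr.2], by linarith [hr.1, hs.2]⟩) (norm_nonneg _))
    s (right_mem_Icc.2 hs.1)
  simp [gronwallBound_ε0_δ0, detF_zero] at hg
  linarith

/-! ### Return to the interval `(-t, t)` -/

section Scaling

theorem pi_smul_measure {n : ℕ} {Y : Type*} [MeasurableSpace Y] (ν : Measure Y) [IsFiniteMeasure ν]
    {c : ENNReal} (hc : c ≠ ⊤) :
    Measure.pi (fun _ : Fin n => c • ν) = c ^ n • Measure.pi fun _ => ν := by
  have : IsFiniteMeasure (c • ν) := ν.smul_finite hc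
  refine Measure.pi_eq fun s _ => ?_
  simp [Measure.pi_pi, Finset.prod_mul_distrib]

theorem map_muJ {t : ℝ} (ht : 0 < t) : volume.restrict (Ioo (-t) t) =
    ENNReal.ofReal t • muJ.map fun u : J => t * (u : ℝ) := by
  have h1 : muJ.map (fun u : J => t * (u : ℝ)) =
      (volume.restrict (Icc (-1) 1)).map fun x : ℝ => t * x := by
    rw [← map_comap_subtype_coe measurableSet_Icc, Measure.map_map (by fun_prop) (by fun_prop)]
    rfl
  have h2 : Icc (-1 : ℝ) 1 = (fun x : ℝ => t * x) ⁻¹' Icc (-t) t := by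
    ext x
    simp only [mem_Icc, mem_preimage]
    constructor
    · rintro ⟨h1, h2⟩
      constructor <;> nlinarith
    · rintro ⟨h1, h2⟩
      constructor <;> nlinarith
  rw [h1, h2, ← Measure.restrict_map (by fun_prop) measurableSet_Icc,
    Real.map_volume_mul_left ht.ne', Measure.restrict_smul, smul_smul,
    ← ENNReal.ofReal_mul ht.le, abs_of_pos (inv_pos.2 ht), mul_inv_cancel₀ ht.ne',
    ENNReal.ofReal_one, one_smul]
  exact Measure.restrict_congr_set Ioo_ae_eq_Icc

theorem kap_sub (t u v : ℝ) : kap t (u - v) = t * sineKernel (t * u) (t * v) := by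
  rw [kap, sineKernel]
  congr 2
  ring

theorem continuous_sineKernel : Continuous fun p : ℝ × ℝ => sineKernel p.1 p.2 := by
  have := continuous_sinc
  unfold sineKernel
  fun_prop

/-- The substitution `x = t u` produces `t ^ n` from the product measure; it is absorbed by
multiplying each of the `n` rows by `t`, which explains the factor `t` in `kap`. -/
theorem fredholmTerm_eq {s : ℝ} (hs : 0 < s) (lam : ℝ) (n : ℕ) :
    fredholmTerm sineKernel (Ioo (-(s / 2)) (s / 2)) lam n =
      (-lam) ^ n / n.factorial * detCoeff muJ (fun x y => sinKer (s / 2) (x, y)) n := by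
  have ht : 0 < s / 2 := by positivity
  set t := s / 2
  rw [fredholmTerm, detCoeff]
  congr 1
  have hφ : Measurable fun u : J => t * (u : ℝ) := by fun_prop
  have hm : Measurable fun (x : Fin n → J) i => t * (x i : ℝ) :=
    measurable_pi_lambda _ fun i => hφ.comp (measurable_pi_apply i)
  have hc : Continuous fun x : Fin n → ℝ =>
      (Matrix.of fun i j : Fin n => sineKernel (x i) (x j)).det := by
    refine Continuous.matrix_det (continuous_pi fun i => continuous_pi fun j => ?_)
    exact continuous_sineKernel.comp (f := fun x : Fin n → ℝ => (x i, x j)) (by fun_prop)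
  rw [map_muJ ht, pi_smul_measure _ ENNReal.ofReal_ne_top,
    ← Measure.pi_map_pi fun _ => hφ.aemeasurable, integral_smul_measure,
    integral_map hm.aemeasurable hc.aestronglyMeasurable, ENNReal.toReal_pow,
    ENNReal.toReal_ofReal ht.le, smul_eq_mul, ← integral_const_mul]
  congr 1 with w
  have : kerMat (fun x y => sinKer t (x, y)) w w =
      t • Matrix.of fun i j : Fin n => sineKernel (t * w i) (t * w j) := by
    ext i j
    exact kap_sub t (w i) (w j)
  rw [this, Matrix.det_smul, Fintype.card_fin]

theorem D_eq {s : ℝ} (hs : 0 < s) (lam : ℝ) : D s lam = detF lam (s / 2) :=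
  tsum_congr fun n => fredholmTerm_eq hs lam n

theorem summable_fredholmTerm {s : ℝ} (hs : 0 < s) (lam : ℝ) :
    Summable (fredholmTerm sineKernel (Ioo (-(s / 2)) (s / 2)) lam) :=
  (summable_fredDet (μ := muJ) (k := fun x y => sinKer (s / 2) (x, y)) (by fun_prop) lam).congr
    fun n => (fredholmTerm_eq hs lam n).symm

end Scaling

/-! ### The resolvent kernel and `σ` -/

section Resolvent

variable {lam t : ℝ}

theorem integral_muJ_comp_mul (f : ℝ → ℝ) :
    t * ∫ u : J, f (t * u) ∂muJ = ∫ x in (-t)..t, f x := by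
  rw [integral_muJ fun u => f (t * u), intervalIntegral.mul_integral_comp_mul_left]
  simp

theorem mul_coe_mem (ht : 0 < t) (u : J) : t * (u : ℝ) ∈ Icc (-t) t := by
  have := u.2
  constructor <;> nlinarith [this.1, this.2]

theorem exists_coe_mul (ht : 0 < t) {x : ℝ} (hx : x ∈ Icc (-t) t) : ∃ u : J, x = t * u :=
  ⟨⟨x / t, by rw [le_div_iff₀ ht]; linarith [hx.1], by rw [div_le_iff₀ ht]; linarith [hx.2]⟩,
    by simp only; field_simp⟩

/-- Any resolvent kernel is given on `[-t, t]` by the inverse of `1 - lam K`. -/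
theorem IsResolventKernel.eq_inv {R : ℝ → ℝ → ℝ} (hR : IsResolventKernel lam t R) (ht : 0 < t)
    (h : IsUnit (opA lam t)) (u v : J) : t * R (t * u) (t * v) = inv lam t (ell lam t v) u := by
  let f : C(J, ℝ) := ⟨fun u => t * R (t * u) (t * v), by
    refine continuous_const.mul (hR.continuousOn.comp_continuous
      (f := fun u : J => (t * (u : ℝ), t * (v : ℝ))) (by fun_prop) fun u => ?_)
    exact ⟨mul_coe_mem ht u, mul_coe_mem ht v⟩⟩
  have hf : opA lam t f = ell lam t v := by
    ext u
    have h1 := hR.left_eq _ (mul_coe_mem ht u) _ (mul_coe_mem ht v)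
    rw [← integral_muJ_comp_mul] at h1
    simp only [opA_apply, ContinuousMap.sub_apply, ContinuousMap.smul_apply, kerOp_apply,
      sinKer_apply, ell_apply, kap_sub, smul_eq_mul, f, ContinuousMap.coe_mk]
    rw [h1, mul_add, ← integral_const_mul, ← integral_const_mul, ← integral_const_mul,
      add_sub_assoc]
    have : ∀ w : J, t * (t * (lam * sineKernel (t * u) (t * w) * R (t * w) (t * v))) =
        lam * (t * sineKernel (t * u) (t * w) * (t * R (t * w) (t * v))) := fun w => by ring
    simp only [this, sub_self, add_zero]
    ring
  rw [← hf, inv_opA h]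
  rfl

theorem exists_isResolventKernel (ht : 0 < t) (h : detF lam t ≠ 0) :
    ∃ R, IsResolventKernel lam t R := by
  let N := minorKer muJ (sinKer t) lam
  let j : ℝ → J := fun x => projIcc (-1) 1 (by norm_num) (x / t)
  have hj : Continuous j := continuous_projIcc.comp (by fun_prop)
  have hju : ∀ u : J, j (t * u) = u := fun u => by
    simp only [j]
    rw [mul_div_cancel_left₀ _ ht.ne', projIcc_val]
  -- Fredholm's resolvent kernel `lam N / D`; the further division by `t` undoes the factor `t` in
  -- the rescaled kernel. Projection to `[-1, 1]` makes the function total and continuous.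
  let R : ℝ → ℝ → ℝ := fun x y => lam / (detF lam t * t) * N (j x, j y)
  have hRc : ContinuousOn (fun p : ℝ × ℝ => R p.1 p.2) (Icc (-t) t ×ˢ Icc (-t) t) := by
    have : Continuous fun p : ℝ × ℝ => R p.1 p.2 := by fun_prop
    exact this.continuousOn
  have hsymm : ∀ x y, R x y = R y x := fun x y => by
    simp only [R, N]
    rw [minorKer_symm (sinKer_symm t)]
  have hleft : ∀ x ∈ Icc (-t) t, ∀ y ∈ Icc (-t) t,
      R x y = lam * sineKernel x y + ∫ z in (-t)..t, lam * sineKernel x z * R z y := by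
    intro x hx y hy
    obtain ⟨u, rfl⟩ := exists_coe_mul ht hx
    obtain ⟨v, rfl⟩ := exists_coe_mul ht hy
    rw [← integral_muJ_comp_mul, ← integral_const_mul]
    have h1 := minorKer_eq (μ := muJ) (K := sinKer t) (lam := lam) u v
    simp only [sinKer_apply, kap_sub] at h1
    simp only [R, hju]
    change N (u, v) = t * sineKernel (t * u) (t * v) * detF lam t +
      lam * ∫ z : J, t * sineKernel (t * u) (t * z) * N (z, v) ∂muJ at h1
    rw [h1, mul_add]
    congr 1
    · field_simp
    · rw [← integral_const_mul, ← integral_const_mul]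
      congr 1 with z
      ring
  refine ⟨R, hRc, hleft, fun x hx y hy => ?_⟩
  rw [hsymm, hleft y hy x hx]
  congr 1
  · rw [sineKernel, sineKernel, ← sinc_neg]
    congr 2
    ring
  · congr 1 with z
    rw [hsymm x z, sineKernel, sineKernel, ← sinc_neg, mul_comm]
    congr 3
    ring

theorem isResolventKernel_resolventKernel (ht : 0 < t) (h : detF lam t ≠ 0) :
    IsResolventKernel lam t (resolventKernel lam t) :=
  Classical.epsilon_spec (exists_isResolventKernel ht h)

theorem IsResolventKernel.unique {R R' : ℝ → ℝ → ℝ} (hR : IsResolventKernel lam t R)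
    (hR' : IsResolventKernel lam t R') (ht : 0 < t) (h : IsUnit (opA lam t)) :
    ∀ x ∈ Icc (-t) t, ∀ y ∈ Icc (-t) t, R x y = R' x y := by
  intro x hx y hy
  obtain ⟨u, rfl⟩ := exists_coe_mul ht hx
  obtain ⟨v, rfl⟩ := exists_coe_mul ht hy
  apply mul_left_cancel₀ ht.ne'
  rw [hR.eq_inv ht h, hR'.eq_inv ht h]

theorem sigma_eq {x : ℝ} (hx : 0 < x) (h : detF lam (x / (2 * π)) ≠ 0) :
    sigma lam x = -(lam * (x / (2 * π)) * (aF lam (x / (2 * π)) + bF lam (x / (2 * π)))) := by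
  have ht : 0 < x / (2 * π) := by positivity
  rw [sigma]
  set t := x / (2 * π)
  have hu := isUnit_of_detF_ne_zero h
  have h1 := (isResolventKernel_resolventKernel ht h).eq_inv ht hu oneJ oneJ
  rw [coe_oneJ, mul_one] at h1
  have h2 : t * resolventKernel lam t t t = G lam t oneJ := h1
  have h3 := G_oneJ hu
  linear_combination (-2) * h2 - h3

end Resolvent

/-! ### The logarithmic derivative, the exponential formula and the Painlevé equation -/

variable {lam t x : ℝ}

theorem hasDerivAt_qF (h : IsUnit (opA lam t)) : HasDerivAt (qF lam)
    (π * pF lam t + lam * (aF lam t - bF lam t) * qF lam t) t := by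
  have := (ContinuousMap.evalCLM ℝ oneJ).hasFDerivAt.comp_hasDerivAt t (hasDerivAt_Q h)
  refine this.congr_deriv ?_
  simp [Q_oneJ, P_oneJ]

theorem hasDerivAt_pF (h : IsUnit (opA lam t)) : HasDerivAt (pF lam)
    (-(π * qF lam t) - lam * (aF lam t - bF lam t) * pF lam t) t := by
  have := (ContinuousMap.evalCLM ℝ oneJ).hasFDerivAt.comp_hasDerivAt t (hasDerivAt_P h)
  refine this.congr_deriv ?_
  simp [Q_oneJ, P_oneJ]

theorem D_div_pi (hx : 0 < x) (lam : ℝ) : D (x / π) lam = detF lam (x / (2 * π)) := by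
  rw [D_eq (by positivity)]
  congr 1
  field_simp

/-- The domain on which `sigma` is smooth. -/
def regularSet (lam : ℝ) : Set ℝ := {x | 0 < x ∧ detF lam (x / (2 * π)) ≠ 0}

theorem isOpen_regularSet (lam : ℝ) : IsOpen (regularSet lam) :=
  (isOpen_lt continuous_const continuous_id).inter
    (isOpen_ne_fun ((continuous_detF lam).comp (by fun_prop)) continuous_const)

theorem hasDerivAt_comp_div {f : ℝ → ℝ} {f' : ℝ} (hf : HasDerivAt f f' (x / (2 * π))) :
    HasDerivAt (fun y => f (y / (2 * π))) (f' / (2 * π)) x := by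
  have h1 : HasDerivAt (fun y => y / (2 * π)) (1 / (2 * π)) x := (hasDerivAt_id x).div_const _
  refine (hf.comp x h1).congr_deriv ?_
  ring

/-- `Real.log` is the logarithm of the absolute value, so nonvanishing suffices and no sign is
needed. -/
theorem hasDerivAt_log_detF (h : detF lam (x / (2 * π)) ≠ 0) :
    HasDerivAt (fun y => Real.log (detF lam (y / (2 * π))))
      (-(lam * (aF lam (x / (2 * π)) + bF lam (x / (2 * π)))) / (2 * π)) x := by
  refine ((hasDerivAt_comp_div (hasDerivAt_detF (isUnit_of_detF_ne_zero h))).log h).congr_deriv ?_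
  field_simp

theorem sigma_div_eq (hx : x ∈ regularSet lam) : sigma lam x / x =
    -(lam * (aF lam (x / (2 * π)) + bF lam (x / (2 * π)))) / (2 * π) := by
  have := hx.1
  rw [sigma_eq hx.1 hx.2]
  field_simp

theorem hasDerivAt_log_D (hx : x ∈ regularSet lam) :
    HasDerivAt (fun y => Real.log (D (y / π) lam)) (sigma lam x / x) x := by
  rw [sigma_div_eq hx]
  refine (hasDerivAt_log_detF hx.2).congr_of_eventuallyEq ?_
  filter_upwards [lt_mem_nhds hx.1] with y hy
  rw [D_div_pi hy]

theorem D_eq_exp {s : ℝ} (hs : 0 < s) (h : ∀ u ∈ Ioc 0 s, D u lam ≠ 0) :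
    IntervalIntegrable (fun x => sigma lam x / x) volume 0 (π * s) ∧
      D s lam = Real.exp (∫ x in (0 : ℝ)..(π * s), sigma lam x / x) := by
  have hd : ∀ u ∈ Icc 0 (s / 2), detF lam u ≠ 0 := by
    intro u hu
    rcases hu.1.eq_or_lt with rfl | hu0
    · simp [detF_zero]
    · have := h (2 * u) ⟨by positivity, by linarith [hu.2]⟩
      rwa [D_eq (by positivity), mul_div_cancel_left₀ u two_ne_zero] at this
  have hps : 0 < π * s := by positivity
  have hd' : ∀ x ∈ Icc 0 (π * s), detF lam (x / (2 * π)) ≠ 0 := fun x hx =>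
    hd _ ⟨div_nonneg hx.1 (by positivity), by
      rw [div_le_iff₀ (by positivity)]; linarith [hx.2]⟩
  -- This agrees with `σ(x) / x` for `x > 0` and is continuous up to `0`, where `A` is the identity;
  -- integrability follows.
  let ψ : ℝ → ℝ := fun x => -(lam * (aF lam (x / (2 * π)) + bF lam (x / (2 * π)))) / (2 * π)
  have hψ : ContinuousOn ψ (uIcc 0 (π * s)) := by
    rw [uIcc_of_le hps.le]
    intro x hx
    have := (hasDerivAt_comp_div
      (hasDerivAt_aF_add_bF (isUnit_of_detF_ne_zero (hd' x hx)))).continuousAt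
    exact ((this.const_mul lam).neg.div_const _).continuousWithinAt
  have heq : EqOn ψ (fun x => sigma lam x / x) (uIoc 0 (π * s)) := by
    rw [uIoc_of_le hps.le]
    intro x hx
    exact (sigma_div_eq ⟨hx.1, hd' x ⟨hx.1.le, hx.2⟩⟩).symm
  refine ⟨hψ.intervalIntegrable.congr heq, ?_⟩
  have hint : ∫ x in (0 : ℝ)..(π * s), ψ x = Real.log (detF lam (s / 2)) := by
    rw [intervalIntegral.integral_eq_sub_of_hasDerivAt (fun x hx => hasDerivAt_log_detF
      (hd' x (by rwa [uIcc_of_le hps.le] at hx))) hψ.intervalIntegrable]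
    have : π * s / (2 * π) = s / 2 := by field_simp
    simp [this, detF_zero]
  -- Without a zero on the way, the sign of `D(0) = 1` persists.
  have hpos : 0 < detF lam (s / 2) := by
    by_contra hneg
    obtain ⟨u, hu, hu0⟩ := intermediate_value_Icc' (by positivity : 0 ≤ s / 2)
      (continuous_detF lam).continuousOn
      (show (0 : ℝ) ∈ Icc (detF lam (s / 2)) (detF lam 0) from
        ⟨not_lt.1 hneg, by simp [detF_zero]⟩)
    exact hd u hu hu0
  rw [← intervalIntegral.integral_congr_ae (ae_of_all _ heq), hint, Real.exp_log hpos, D_eq hs]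

/-- The first derivative of `sigma`. -/
noncomputable def sigmaDeriv (lam x : ℝ) : ℝ :=
  -(lam * (pF lam (x / (2 * π)) ^ 2 + qF lam (x / (2 * π)) ^ 2)) / π

/-- The second derivative of `sigma`. -/
noncomputable def sigmaDeriv2 (lam x : ℝ) : ℝ :=
  -(lam / π ^ 2 * (lam * (aF lam (x / (2 * π)) - bF lam (x / (2 * π))) *
    (qF lam (x / (2 * π)) ^ 2 - pF lam (x / (2 * π)) ^ 2)))

/-- Differentiating `t (a + b)` gives `a + b + lam t (a - b)²`, which is exactly `2 (p² + q²)` by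
`aF_add_bF_eq`. -/
theorem hasDerivAt_sigma (hx : x ∈ regularSet lam) :
    HasDerivAt (sigma lam) (sigmaDeriv lam x) x := by
  have hu := isUnit_of_detF_ne_zero hx.2
  have h1 := (((hasDerivAt_id (x / (2 * π))).const_mul lam).mul (hasDerivAt_aF_add_bF hu)).neg
  have h2 := hasDerivAt_comp_div h1
  refine (h2.congr_of_eventuallyEq ?_).congr_deriv ?_
  · filter_upwards [(isOpen_regularSet lam).mem_nhds hx] with y hy
    rw [sigma_eq hy.1 hy.2]
    rfl
  · have h3 := aF_add_bF_eq hu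
    simp only [id, sigmaDeriv]
    rw [h3]
    field_simp
    ring

theorem hasDerivAt_sigmaDeriv (hx : x ∈ regularSet lam) :
    HasDerivAt (sigmaDeriv lam) (sigmaDeriv2 lam x) x := by
  have hu := isUnit_of_detF_ne_zero hx.2
  have h1 := ((((hasDerivAt_pF hu).pow 2).add ((hasDerivAt_qF hu).pow 2)).const_mul lam).neg
  refine ((hasDerivAt_comp_div h1).div_const π).congr_deriv ?_
  simp only [sigmaDeriv2]
  field_simp
  ring

theorem continuousOn_sigmaDeriv2 : ContinuousOn (sigmaDeriv2 lam) (regularSet lam) := by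
  intro x hx
  have hu := isUnit_of_detF_ne_zero hx.2
  have ha := (hasDerivAt_comp_div (hasDerivAt_aF hu)).continuousAt
  have hb := (hasDerivAt_comp_div (hasDerivAt_bF hu)).continuousAt
  have hp := (hasDerivAt_comp_div (hasDerivAt_pF hu)).continuousAt
  have hq := (hasDerivAt_comp_div (hasDerivAt_qF hu)).continuousAt
  exact ((((ha.sub hb).const_mul lam).mul ((hq.pow 2).sub (hp.pow 2))).const_mul
    (lam / π ^ 2)).neg.continuousWithinAt

theorem contDiffAt_sigma (hx : x ∈ regularSet lam) : ContDiffAt ℝ 2 (sigma lam) x := by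
  have ho := isOpen_regularSet lam
  have h1 : ContDiffOn ℝ 1 (sigmaDeriv lam) (regularSet lam) := by
    refine (contDiffOn_succ_iff_deriv_of_isOpen (n := 0) ho).2 ⟨fun y hy =>
      (hasDerivAt_sigmaDeriv hy).differentiableAt.differentiableWithinAt, by simp, ?_⟩
    rw [contDiffOn_zero]
    exact continuousOn_sigmaDeriv2.congr fun y hy => (hasDerivAt_sigmaDeriv hy).deriv
  have h2 : ContDiffOn ℝ 2 (sigma lam) (regularSet lam) := by
    refine (contDiffOn_succ_iff_deriv_of_isOpen (n := 1) ho).2 ⟨fun y hy =>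
      (hasDerivAt_sigma hy).differentiableAt.differentiableWithinAt, by simp, ?_⟩
    exact h1.congr fun y hy => (hasDerivAt_sigma hy).deriv
  exact h2.contDiffAt (ho.mem_nhds hx)

/-- Once `t (a - b)` is replaced by `-2 p q / π`, every term is a polynomial in `p` and `q`, and the
equation reduces to `(p² + q²)² - 4 p² q² = (p² - q²)²`. -/
theorem sigma_equation (hx : x ∈ regularSet lam) :
    (x * deriv (deriv (sigma lam)) x) ^ 2 +
      4 * (x * deriv (sigma lam) x - sigma lam x) *
        (x * deriv (sigma lam) x - sigma lam x + deriv (sigma lam) x ^ 2) = 0 := by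
  have hu := isUnit_of_detF_ne_zero hx.2
  have hd : deriv (deriv (sigma lam)) x = sigmaDeriv2 lam x := by
    refine ((hasDerivAt_sigmaDeriv hx).congr_of_eventuallyEq ?_).deriv
    filter_upwards [(isOpen_regularSet lam).mem_nhds hx] with y hy
    exact (hasDerivAt_sigma hy).deriv
  have h1 := mul_aF_sub_bF hu
  have h2 := aF_add_bF_eq hu
  rw [hd, (hasDerivAt_sigma hx).deriv, sigma_eq hx.1 hx.2, sigmaDeriv, sigmaDeriv2]
  obtain ⟨τ, hτ⟩ : ∃ τ, τ = x / (2 * π) := ⟨_, rfl⟩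
  have hxτ : x = 2 * π * τ := by rw [hτ]; field_simp
  rw [← hτ] at h1 h2 ⊢
  rw [hxτ, h2]
  set v := aF lam τ - bF lam τ
  set p := pF lam τ
  set q := qF lam τ
  have hv : τ * v = -2 * (p * q) / π := by
    rw [← h1]
    field_simp
  have e1 : 2 * π * τ * -(lam / π ^ 2 * (lam * v * (q ^ 2 - p ^ 2))) =
      -(2 * lam ^ 2 / π * (τ * v) * (q ^ 2 - p ^ 2)) := by
    field_simp
  have e2 : 2 * π * τ * (-(lam * (p ^ 2 + q ^ 2)) / π) -
      -(lam * τ * (2 * (p ^ 2 + q ^ 2) - τ * lam * v ^ 2)) = -(lam * (τ * v)) ^ 2 := by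
    field_simp
    ring
  rw [e1, e2, hv]
  field_simp
  ring

/-! ### Behaviour at the origin -/

section Boundary

theorem opA_zero (lam : ℝ) : opA lam 0 = 1 := by
  ext f u
  simp [opA_apply, sinKer_zero]

theorem inv_zero (lam : ℝ) : inv lam 0 = 1 := by
  rw [inv, opA_zero, Ring.inverse_one]

theorem aF_zero (lam : ℝ) : aF lam 0 = 0 := by
  have : sinF 0 = 0 := by ext; simp
  rw [aF, this]
  simp

theorem bF_zero (lam : ℝ) : bF lam 0 = 2 := by
  have h := integral_muJ fun _ => 1
  simp only [bF, P, inv_zero, pairing_apply, one_apply_eq_self, cosF_apply,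
    mul_zero, zero_mul, cos_zero, mul_one, h]
  norm_num

/-- The derivative `lam (a - b)²` equals `4 lam` at `0` and is itself differentiable there, so it
differs from `4 lam` by `O(t)`; the mean value inequality turns this into a second-order remainder.
-/
theorem exists_aF_add_bF_bound (lam : ℝ) : ∃ M δ : ℝ, 0 < δ ∧ ∀ t ∈ Ico 0 δ,
    detF lam t ≠ 0 ∧ |aF lam t + bF lam t - 2 - 4 * lam * t| ≤ M * t ^ 2 := by
  have h0 : IsUnit (opA lam 0) := isUnit_of_detF_ne_zero (by simp [detF_zero])
  have hv := ((hasDerivAt_aF h0).sub (hasDerivAt_bF h0)).differentiableAt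
  have hw : DifferentiableAt ℝ (fun t => lam * ((aF lam t - bF lam t) ^ 2 - 4)) 0 :=
    ((hv.pow 2).sub_const 4).const_mul lam
  obtain ⟨M, hM⟩ := hw.isBigO_sub.bound
  have hd : ∀ᶠ t in 𝓝 (0 : ℝ), detF lam t ≠ 0 :=
    (continuous_detF lam).continuousAt.eventually_ne (by simp [detF_zero])
  obtain ⟨δ, hδ, hball⟩ := Metric.eventually_nhds_iff.1 (hM.and hd)
  have hb : ∀ t ∈ Ico 0 δ, |lam * ((aF lam t - bF lam t) ^ 2 - 4)| ≤ M * t ∧ detF lam t ≠ 0 := by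
    intro t ht
    have := hball (y := t) (by rw [Real.dist_eq, sub_zero, abs_of_nonneg ht.1]; exact ht.2)
    rw [aF_zero, bF_zero, sub_zero, Real.norm_eq_abs, Real.norm_eq_abs, abs_of_nonneg ht.1] at this
    refine ⟨le_of_eq_of_le ?_ this.1, this.2⟩
    norm_num
  refine ⟨M, δ, hδ, fun t ht => ⟨(hb t ht).2, ?_⟩⟩
  have key := (convex_Icc (0 : ℝ) t).norm_image_sub_le_of_norm_hasDerivWithin_le
    (f := fun s => aF lam s + bF lam s - 2 - 4 * lam * s) (C := M * t)
    (f' := fun s => lam * ((aF lam s - bF lam s) ^ 2 - 4)) (x := 0) (y := t)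
    (fun s hs => ?_) (fun s hs => ?_) ⟨le_rfl, ht.1⟩ ⟨ht.1, le_rfl⟩
  · simp only [aF_zero, bF_zero, Real.norm_eq_abs, sub_zero, abs_of_nonneg ht.1] at key
    calc _ = _ := by norm_num
      _ ≤ M * t * t := key
      _ = M * t ^ 2 := by ring
  · have hu := isUnit_of_detF_ne_zero (hb s ⟨hs.1, hs.2.trans_lt ht.2⟩).2
    refine ((((hasDerivAt_aF_add_bF hu).sub_const 2).sub
      ((hasDerivAt_id s).const_mul (4 * lam))).congr_deriv ?_).hasDerivWithinAt
    ring
  · have h1 := hb s ⟨hs.1, hs.2.trans_lt ht.2⟩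
    have h2 := hb t ht
    -- The sign of `M` is not known in advance: for `s > 0` the bound itself forces `M ≥ 0`, while
    -- at `s = 0` the derivative vanishes.
    rcases hs.1.eq_or_lt with rfl | hs0
    · simpa [aF_zero, bF_zero, show (2 : ℝ) ^ 2 - 4 = 0 by norm_num] using
        (abs_nonneg _).trans h2.1
    · have hM0 : 0 ≤ M := nonneg_of_mul_nonneg_left ((abs_nonneg _).trans h1.1) hs0
      exact h1.1.trans (mul_le_mul_of_nonneg_left hs.2 hM0)

theorem sigma_boundary (lam : ℝ) :
    (fun x : ℝ => sigma lam x - (-(lam / π) * x - (lam / π) ^ 2 * x ^ 2))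
      =O[𝓝[>] (0 : ℝ)] (fun x : ℝ => x ^ 3) := by
  obtain ⟨M, δ, hδ, hM⟩ := exists_aF_add_bF_bound lam
  have hev : ∀ᶠ x in 𝓝[>] (0 : ℝ), x ∈ Ioo 0 (2 * π * δ) := Ioo_mem_nhdsGT (by positivity)
  refine Asymptotics.IsBigO.of_bound (|lam| * M / (2 * π) ^ 3) ?_
  filter_upwards [hev] with x hx
  have hτ : x / (2 * π) ∈ Ico 0 δ :=
    ⟨div_nonneg hx.1.le (by positivity), by rw [div_lt_iff₀ (by positivity)]; linarith [hx.2]⟩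
  obtain ⟨h1, h2⟩ := hM _ hτ
  rw [sigma_eq hx.1 h1]
  have hx0 := hx.1
  have e : -(lam * (x / (2 * π)) * (aF lam (x / (2 * π)) + bF lam (x / (2 * π)))) -
      (-(lam / π) * x - (lam / π) ^ 2 * x ^ 2) = -(lam * (x / (2 * π)) *
        (aF lam (x / (2 * π)) + bF lam (x / (2 * π)) - 2 - 4 * lam * (x / (2 * π)))) := by
    field_simp
    ring
  rw [e, norm_neg, norm_mul, norm_mul, Real.norm_eq_abs, Real.norm_eq_abs, Real.norm_eq_abs,
    Real.norm_eq_abs, abs_of_nonneg hτ.1, abs_of_pos (pow_pos hx0 3)]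
  calc _ ≤ |lam| * (x / (2 * π)) * (M * (x / (2 * π)) ^ 2) :=
        mul_le_mul_of_nonneg_left h2 (mul_nonneg (abs_nonneg _) hτ.1)
    _ = |lam| * M / (2 * π) ^ 3 * x ^ 3 := by field_simp

end Boundary

end SineProcess

theorem theorem9 (lam : ℝ) :
    -- the Fredholm expansion converges, so that `D(s; lam)` is its sum
    (∀ s : ℝ, 0 < s → Summable
      (SineProcess.fredholmTerm SineProcess.sineKernel (Ioo (-(s / 2)) (s / 2)) lam)) ∧
    -- for `lam ≤ 1` the determinant has no zero
    (lam ≤ 1 → ∀ s : ℝ, 0 < s → 0 < SineProcess.D s lam) ∧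
    -- the resolvent kernel exists and is unique, wherever the determinant is not zero
    (∀ t : ℝ, 0 < t → SineProcess.D (2 * t) lam ≠ 0 →
      SineProcess.IsResolventKernel lam t (SineProcess.resolventKernel lam t) ∧
      ∀ R : ℝ → ℝ → ℝ, SineProcess.IsResolventKernel lam t R →
        ∀ x ∈ Icc (-t) t, ∀ y ∈ Icc (-t) t, R x y = SineProcess.resolventKernel lam t x y) ∧
    -- `σ = x d/dx log D(x/π; lam)`
    (∀ x : ℝ, 0 < x → SineProcess.D (x / π) lam ≠ 0 →
      HasDerivAt (fun y : ℝ => Real.log (SineProcess.D (y / π) lam))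
        (SineProcess.sigma lam x / x) x) ∧
    -- the representation of the determinant
    (∀ s : ℝ, 0 < s → (∀ u ∈ Ioc 0 s, SineProcess.D u lam ≠ 0) →
      IntervalIntegrable (fun x : ℝ => SineProcess.sigma lam x / x) volume 0 (π * s) ∧
      SineProcess.D s lam = Real.exp (∫ x in (0 : ℝ)..(π * s), SineProcess.sigma lam x / x)) ∧
    -- the differential equation
    (∀ x : ℝ, 0 < x → SineProcess.D (x / π) lam ≠ 0 →
      ContDiffAt ℝ 2 (SineProcess.sigma lam) x ∧
      (x * deriv (deriv (SineProcess.sigma lam)) x) ^ 2 +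
        4 * (x * deriv (SineProcess.sigma lam) x - SineProcess.sigma lam x) *
          (x * deriv (SineProcess.sigma lam) x - SineProcess.sigma lam x +
            (deriv (SineProcess.sigma lam) x) ^ 2) = 0) ∧
    -- the boundary condition
    (fun x : ℝ => SineProcess.sigma lam x - (-(lam / π) * x - (lam / π) ^ 2 * x ^ 2))
      =O[𝓝[>] (0 : ℝ)] (fun x : ℝ => x ^ 3) := by
  refine ⟨fun s hs => SineProcess.summable_fredholmTerm hs lam, fun hlam s hs => ?_,
    fun t ht hD => ?_, fun x hx hD => ?_, fun s hs h => SineProcess.D_eq_exp hs h,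
    fun x hx hD => ?_, SineProcess.sigma_boundary lam⟩
  · rw [SineProcess.D_eq hs]
    exact SineProcess.detF_pos hlam (by positivity)
  · rw [SineProcess.D_eq (by positivity), mul_div_cancel_left₀ t two_ne_zero] at hD
    have h := SineProcess.isResolventKernel_resolventKernel ht hD
    exact ⟨h, fun R hR => hR.unique h ht (SineProcess.isUnit_of_detF_ne_zero hD)⟩
  · rw [SineProcess.D_div_pi hx] at hD
    exact SineProcess.hasDerivAt_log_D ⟨hx, hD⟩
  · rw [SineProcess.D_div_pi hx] at hD
    exact ⟨SineProcess.contDiffAt_sigma ⟨hx, hD⟩, SineProcess.sigma_equation ⟨hx, hD⟩⟩
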